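/- Let $m\ge 1$ and $n\ge 0$ be integers, let $\mathbb B\subset\mathbb C^n$ be the open Euclidean unit ball, and let $H,\mathcal E_*,\mathcal E$ be complex Hilbert spaces. For a commuting tuple $T=(T_1,\dots,T_n)\in L(H)^n$ put $\sigma_T(X)=\sum_{i=1}^n T_iXT_i^*$ for $X\in L(H)$ and $\Delta_T^{(k)}=(1-\sigma_T)^k(1_H)$ for $k\in\mathbb N$. The tuple $T$ is an $m$-hypercontraction if $\Delta_T^{(1)}\ge 0$ and $\Delta_T^{(m)}\ge 0$, and it is of class $C_{\cdot 0}$ (pure) if $\sigma_T^k(1_H)\to 0$ strongly as $k\to\infty$. Write $T^*:H\to H^n$, $h\mapsto(T_i^*h)_{i}$, and, for $z\in\mathbb B$, $Z:H^n\to H$, $(h_i)_i\mapsto\sum_i z_ih_i$. For $\alpha\in\mathbb N^n$ let $\rho_m(\alpha)=\frac{(m+|\alpha|-1)!}{\alpha!\,(m-1)!}$, and let $H_m(\mathbb B,\mathcal E)$ be the Hilbert space of all analytic functions $f=\sum_\alpha f_\alpha z^\alpha:\mathbb B\to\mathcal E$ with $\|f\|^2=\sum_\alpha \|f_\alpha\|^2/\rho_m(\alpha)<\infty$,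 that is, the functional Hilbert space with reproducing kernel $(1-\langle z,w\rangle)^{-m}1_{\mathcal E}$. Let $M_z=(M_{z_1},\dots,M_{z_n})$ be the tuple of multiplication operators with the coordinate functions on $H_m(\mathbb B,\mathcal E)$, and let $M_z^*f=(M_{z_i}^*f)_{i=1}^n\in H_m(\mathbb B,\mathcal E)^n$. A function $W:\mathbb B\to L(\mathcal E_*,\mathcal E)$ is called $K_m$-inner if it is analytic, the map $x\mapsto Wx$ (where $(Wx)(z)=W(z)x$) is an isometry from $\mathcal E_*$ into $H_m(\mathbb B,\mathcal E)$, and $W\mathcal E_*\perp M_z^\alpha(W\mathcal E_*)$ for all $\alpha\in\mathbb N^n\setminus\{0\}$. **Theorem.** Let $T\in L(H)^n$ be an $m$-hypercontraction of class $C_{\cdot 0}$, and let $B\in L(\mathcal E_*,H^n)$, $C\in L(H,\mathcal E)$, $D\in L(\mathcal E_*,\mathcal E)$ be such that - (KI1) $C^*C=\Delta_T^{(m)}$, - (KI2) $D^*C=-B^*\bigl(\bigoplus\sum_{k=0}^{m-1}\Delta_T^{(k)}\bigr)T^*$, - (KI3) $D^*D+B^*\bigl(\bigoplus\sum_{k=0}^{m-1}\Delta_T^{(k)}\bigr)B=1_{\mathcal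 E_*}$, - (KI4) $\operatorname{Im}\bigl((\bigoplus j_C)B\bigr)\subset M_z^*H_m(\mathbb B,\mathcal E)$, where $j_C:H\to H_m(\mathbb B,\mathcal E)$, $j_Cx=\sum_{\alpha\in\mathbb N^n}\rho_m(\alpha)(CT^{*\alpha}x)z^\alpha$. Here $\bigoplus X$ denotes the componentwise action $(h_i)_{i=1}^n\mapsto(Xh_i)_{i=1}^n$. Let $W:\mathbb B\to L(\mathcal E_*,\mathcal E)$ be given by $$W(z)=D+C\sum_{k=1}^m(1_H-ZT^*)^{-k}ZB\qquad(z\in\mathbb B).$$ Then $W$ is a $K_m$-inner function. -/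

import Mathlib

noncomputable section

open Filter Topology
open scoped Nat

set_option linter.unusedSectionVars false

namespace BallSpace

variable {n : ℕ}

/-- The length `|α|` of a multi-index. -/
def len (α : Fin n → ℕ) : ℕ := ∑ i, α i

/-- The monomial `z ^ α`. -/
def mono {R : Type*} [CommMonoid R] (z : Fin n → R) (α : Fin n → ℕ) : R := ∏ i, z i ^ α i

/-- The weights `ρ_m(α) = (m + |α| - 1)! / (α! (m - 1)!)` for `m ≥ 1`. -/
def rho (m : ℕ) (α : Fin n → ℕ) : ℝ :=
  ((m + len α - 1)! : ℝ) / ((∏ i, (α i)! : ℕ) * ((m - 1)! : ℝ))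

lemma rho_pos (m : ℕ) (α : Fin n → ℕ) : 0 < rho m α := by
  have : 0 < ∏ i, (α i)! := Finset.prod_pos fun i _ => Nat.factorial_pos _
  unfold rho
  positivity

lemma rho_eq (m : ℕ) [NeZero m] (α : Fin n → ℕ) :
    rho m α = ((len α + (m - 1)).choose (m - 1) : ℝ) * (Nat.multinomial Finset.univ α : ℝ) := by
  have h1 := Nat.multinomial_spec Finset.univ α
  have h2 := Nat.add_choose_mul_factorial_mul_factorial (len α) (m - 1)
  have hm : m + len α - 1 = len α + (m - 1) := by
    have := NeZero.one_le (n := m)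
    omega
  have h3 : (∏ i, (α i)!) ≠ 0 := Finset.prod_ne_zero_iff.2 fun i _ => Nat.factorial_ne_zero _
  have h4 : ((m - 1)!) ≠ 0 := Nat.factorial_ne_zero _
  unfold rho
  rw [hm, div_eq_iff (by exact_mod_cast mul_ne_zero h3 h4), ← h2]
  have h5 : (len α)! = (∏ i, (α i)!) * Nat.multinomial Finset.univ α := h1.symm
  rw [h5]
  have h6 : (len α + (m - 1)).choose (m - 1) = (len α + (m - 1)).choose (len α) :=
    (Nat.choose_symm_add).symm
  rw [h6]
  push_cast
  ring

lemma fiber_sum {𝕜 : Type*} [RCLike 𝕜] (m : ℕ) [NeZero m] (x : Fin n → 𝕜) (k : ℕ) :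
    ∑ α ∈ Finset.piAntidiag Finset.univ k, (rho m α : 𝕜) * mono x α =
      ((k + (m - 1)).choose (m - 1) : 𝕜) * (∑ i, x i) ^ k := by
  rw [Finset.sum_pow_eq_sum_piAntidiag, Finset.mul_sum]
  refine Finset.sum_congr rfl fun α hα => ?_
  have hk : len α = k := by simpa [len] using hα
  rw [rho_eq, hk, mono]
  push_cast
  ring

lemma hasSum_fiber {F : Type*} [NormedAddCommGroup F] {f : (Fin n → ℕ) → F} {a : F}
    (h : HasSum f a) :
    HasSum (fun k => ∑ α ∈ Finset.piAntidiag (Finset.univ : Finset (Fin n)) k, f α) a := by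
  have h1 := ((Equiv.sigmaFiberEquiv (len (n := n))).hasSum_iff).2 h
  refine h1.sigma fun k => ?_
  have : ∑ α ∈ Finset.piAntidiag (Finset.univ : Finset (Fin n)) k, f α =
      ∑ α : {α : Fin n → ℕ // α ∈ Finset.piAntidiag (Finset.univ : Finset (Fin n)) k}, f α.1 :=
    (Finset.sum_coe_sort _ _).symm
  rw [this]
  have h2 := hasSum_fintype
    (fun α : {α : Fin n → ℕ // α ∈ Finset.piAntidiag (Finset.univ : Finset (Fin n)) k} => f α.1)
  refine ((Equiv.subtypeEquivRight (p := fun α : Fin n → ℕ => len α = k)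
    (q := fun α => α ∈ Finset.piAntidiag (Finset.univ : Finset (Fin n)) k)
    (fun α => by simp [len])).hasSum_iff).2 h2

lemma summable_rho (m : ℕ) [NeZero m] (x : Fin n → ℝ) (h0 : ∀ i, 0 ≤ x i) (h1 : ∑ i, x i < 1) :
    Summable fun α => rho m α * mono x α := by
  have hmono : ∀ α, 0 ≤ rho m α * mono x α := fun α =>
    mul_nonneg (rho_pos m α).le (Finset.prod_nonneg fun i _ => pow_nonneg (h0 i) _)
  have hs0 : 0 ≤ ∑ i, x i := Finset.sum_nonneg fun i _ => h0 i
  have hg := summable_choose_mul_geometric_of_norm_lt_one (R := ℝ) (m - 1) (r := ∑ i, x i)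
    (by rwa [Real.norm_of_nonneg hs0])
  refine summable_of_sum_le (c := ∑' k, ((k + (m - 1)).choose (m - 1) : ℝ) * (∑ i, x i) ^ k)
    hmono fun u => ?_
  have hsub : u ⊆ (u.image len).biUnion
      fun k => Finset.piAntidiag (Finset.univ : Finset (Fin n)) k := by
    intro α hα
    simp only [Finset.mem_biUnion, Finset.mem_image]
    exact ⟨len α, ⟨α, hα, rfl⟩, by simp [len]⟩
  calc ∑ α ∈ u, rho m α * mono x α
      ≤ ∑ α ∈ (u.image len).biUnion
          fun k => Finset.piAntidiag (Finset.univ : Finset (Fin n)) k, rho m α * mono x α :=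
        Finset.sum_le_sum_of_subset_of_nonneg hsub fun α _ _ => hmono α
    _ = ∑ k ∈ u.image len, ((k + (m - 1)).choose (m - 1) : ℝ) * (∑ i, x i) ^ k := by
        rw [Finset.sum_biUnion]
        · exact Finset.sum_congr rfl fun k _ => by simpa using fiber_sum (𝕜 := ℝ) m x k
        · intro a _ b _ hab
          refine Finset.disjoint_left.2 fun α ha hb => hab ?_
          simp only [Finset.mem_piAntidiag] at ha hb
          rw [← ha.1, ← hb.1]
    _ ≤ _ := hg.sum_le_tsum _ fun k _ => by positivity

/-- The binomial series `∑ ρ_m(α) x ^ α = (1 - ∑ x_i) ^ (-m)`. -/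
lemma hasSum_rho (m : ℕ) [NeZero m] (x : Fin n → ℂ) (hx : ∑ i, ‖x i‖ < 1) :
    HasSum (fun α => (rho m α : ℂ) * mono x α) (((1 - ∑ i, x i) ^ m)⁻¹) := by
  have hs : Summable fun α => (rho m α : ℂ) * mono x α := by
    refine Summable.of_norm ?_
    refine (summable_rho m (fun i => ‖x i‖) (fun i => norm_nonneg _) hx).congr fun α => ?_
    simp [mono, abs_of_pos (rho_pos m α)]
  have h1 := hasSum_fiber hs.hasSum
  have h2 := hasSum_choose_mul_geometric_of_norm_lt_one (𝕜 := ℂ) (m - 1) (r := ∑ i, x i)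
    ((norm_sum_le _ _).trans_lt hx)
  have h3 : (fun k => ∑ α ∈ Finset.piAntidiag (Finset.univ : Finset (Fin n)) k,
      (rho m α : ℂ) * mono x α) =
      fun k => ((k + (m - 1)).choose (m - 1) : ℂ) * (∑ i, x i) ^ k := by
    funext k
    simpa using fiber_sum (𝕜 := ℂ) m x k
  rw [h3] at h1
  have h4 := h1.unique h2
  rw [Nat.sub_add_cancel NeZero.one_le, one_div] at h4
  rw [← h4]
  exact hs.hasSum

/-- The open Euclidean unit ball of `ℂⁿ`, as a type. -/
abbrev Ball (n : ℕ) : Type := Metric.ball (0 : EuclideanSpace ℂ (Fin n)) 1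

lemma ball_sum_lt (z : Ball n) : ∑ i, ‖z.1 i‖ ^ 2 < 1 := by
  have h : ‖z.1‖ < 1 := mem_ball_zero_iff.1 z.2
  rw [← EuclideanSpace.norm_sq_eq]
  nlinarith [norm_nonneg z.1]

/-- The coefficient sequence `α ↦ ρ_m(α) ^ (1/2) z ^ α`, square summable for `z` in the ball. -/
def weight (m : ℕ) [NeZero m] (z : Ball n) : lp (fun _ : Fin n → ℕ => ℂ) 2 :=
  ⟨fun α => (√(rho m α) : ℂ) * mono z.1 α, by
    refine memℓp_gen ?_
    have h := summable_rho m (fun i => ‖z.1 i‖ ^ 2) (fun i => by positivity) (ball_sum_lt z)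
    refine h.congr fun α => ?_
    simp only [ENNReal.toReal_ofNat, Real.rpow_ofNat, norm_mul, Complex.norm_real, mul_pow,
      Real.norm_eq_abs, sq_abs, Real.sq_sqrt (rho_pos m α).le, mono, norm_prod, norm_pow,
      ← Finset.prod_pow]
    congr 1
    exact Finset.prod_congr rfl fun i _ => by ring⟩

section Space

variable {m : ℕ} {E : Type*} [NormedAddCommGroup E] [InnerProductSpace ℂ E]

/-- The space `H_m(𝔹, E)` of all functions `f = ∑ f_α z ^ α` on the unit ball of `ℂⁿ` with
`‖f‖² = ∑ ‖f_α‖² / ρ_m(α) < ∞`.  The function `f` is stored as the square summable family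
`x_α = ρ_m(α) ^ (-1/2) f_α`; the coercion of its elements to functions on the ball is
`f z = ∑ ρ_m(α) ^ (1/2) z ^ α x_α`, see `HmBall.apply_eq` below. -/
def HmBall (m n : ℕ) (E : Type*) [NormedAddCommGroup E] : Type _ :=
  lp (fun _ : Fin n → ℕ => E) 2

instance : NormedAddCommGroup (HmBall m n E) :=
  inferInstanceAs (NormedAddCommGroup (lp (fun _ : Fin n → ℕ => E) 2))

instance : InnerProductSpace ℂ (HmBall m n E) :=
  inferInstanceAs (InnerProductSpace ℂ (lp (fun _ : Fin n → ℕ => E) 2))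

instance [CompleteSpace E] : CompleteSpace (HmBall m n E) :=
  inferInstanceAs (CompleteSpace (lp (fun _ : Fin n → ℕ => E) 2))

/-- The normalized coefficient `x_α = ρ_m(α) ^ (-1/2) f_α`. -/
def HmBall.ncoeff (f : HmBall m n E) : (Fin n → ℕ) → E :=
  (show lp (fun _ : Fin n → ℕ => E) 2 from f).1

variable [NeZero m]

lemma HmBall.summable_norm (z : Ball n) (f : HmBall m n E) :
    (Summable fun α => ‖weight m z α‖ * ‖f.ncoeff α‖) ∧
      ∑' α, ‖weight m z α‖ * ‖f.ncoeff α‖ ≤ ‖weight m z‖ * ‖f‖ := by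
  have hpq : (2 : ENNReal).toReal.HolderConjugate (2 : ENNReal).toReal := by
    rw [Real.holderConjugate_iff]; norm_num
  have hf := lp.hasSum_norm hpq.pos (weight m z)
  have hg := lp.hasSum_norm hpq.pos (show lp (fun _ : Fin n → ℕ => E) 2 from f)
  obtain ⟨C, -, hC, hsum⟩ := Real.inner_le_Lp_mul_Lq_hasSum_of_nonneg hpq (norm_nonneg _)
    (norm_nonneg _) (fun _ => norm_nonneg _) (fun _ => norm_nonneg _) hf hg
  exact ⟨hsum.summable, hsum.tsum_eq.trans_le hC⟩

variable [CompleteSpace E]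

lemma HmBall.summable_eval (z : Ball n) (f : HmBall m n E) :
    Summable fun α => weight m z α • f.ncoeff α :=
  Summable.of_norm (by simpa only [norm_smul] using (HmBall.summable_norm z f).1)

/-- Point evaluation `f ↦ ∑ ρ_m(α) ^ (1/2) z ^ α x_α`. -/
def HmBall.evalCLM (z : Ball n) : HmBall m n E →L[ℂ] E :=
  LinearMap.mkContinuous
    { toFun := fun f => ∑' α, weight m z α • f.ncoeff α
      map_add' := fun f g => by
        rw [← (HmBall.summable_eval z f).tsum_add (HmBall.summable_eval z g)]
        exact tsum_congr fun α => smul_add _ _ _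
      map_smul' := fun c f => by
        rw [RingHom.id_apply, ← (HmBall.summable_eval z f).tsum_const_smul c]
        exact tsum_congr fun α => smul_comm _ _ _ }
    ‖weight m z‖ (fun f => by
      obtain ⟨h1, h2⟩ := HmBall.summable_norm z f
      refine le_trans ?_ h2
      simp only [← norm_smul] at h1 ⊢
      exact norm_tsum_le_tsum_norm h1)

lemma HmBall.hasSum_eval (z : Ball n) (f : HmBall m n E) :
    HasSum (fun α => weight m z α • f.ncoeff α) (HmBall.evalCLM z f) :=
  (HmBall.summable_eval z f).hasSum

lemma HmBall.ncoeff_eq_zero (f : HmBall m n E) (h : ∀ z, HmBall.evalCLM z f = 0) : f = 0 := by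
  have hP : ∀ (z : Ball n) (k : ℕ), ∑ α ∈ Finset.piAntidiag (Finset.univ : Finset (Fin n)) k,
      weight m z α • f.ncoeff α = 0 := by
    intro z k
    set a : ℕ → E := fun k => ∑ α ∈ Finset.piAntidiag (Finset.univ : Finset (Fin n)) k,
      weight m z α • f.ncoeff α with ha
    let p : FormalMultilinearSeries ℂ ℂ E :=
      fun k => ContinuousMultilinearMap.mkPiRing ℂ (Fin k) (a k)
    have hp : HasFPowerSeriesAt (0 : ℂ → E) p 0 := by
      rw [hasFPowerSeriesAt_iff]
      filter_upwards [Metric.ball_mem_nhds (0 : ℂ) one_pos] with t ht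
      have ht' : ‖t‖ < 1 := by simpa using ht
      have hz : ‖z.1‖ < 1 := mem_ball_zero_iff.1 z.2
      have htz : t • z.1 ∈ Metric.ball (0 : EuclideanSpace ℂ (Fin n)) 1 := by
        simp only [Metric.mem_ball, dist_zero_right, norm_smul]
        nlinarith [norm_nonneg t, norm_nonneg z.1]
      have h1 := hasSum_fiber (HmBall.hasSum_eval ⟨t • z.1, htz⟩ f)
      rw [h] at h1
      refine h1.congr_fun fun k => ?_
      have : p.coeff k = a k := by simp [p, FormalMultilinearSeries.coeff]
      rw [this, ha, Finset.smul_sum]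
      refine Finset.sum_congr rfl fun α hα => ?_
      have hk : len α = k := by simpa [len] using hα
      have : weight m ⟨t • z.1, htz⟩ α = t ^ k * weight m z α := by
        simp only [weight, mono, PiLp.smul_apply, smul_eq_mul, mul_pow, Finset.prod_mul_distrib,
          Finset.prod_pow_eq_pow_sum]
        rw [← hk, len]
        ring
      rw [this, mul_smul]
    have := congrArg (fun q => FormalMultilinearSeries.coeff q k) hp.eq_zero
    simpa [p, FormalMultilinearSeries.coeff] using this
  have key : ∀ α, f.ncoeff α = 0 := by
    intro α
    refine ext_inner_left ℂ fun e => ?_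
    set k := len α with hk
    let q : MvPolynomial (Fin n) ℂ := ∑ β ∈ Finset.piAntidiag (Finset.univ : Finset (Fin n)) k,
      MvPolynomial.monomial (Finsupp.equivFunOnFinite.symm β)
        ((√(rho m β) : ℂ) * inner ℂ e (f.ncoeff β))
    have hev : ∀ z : Ball n, MvPolynomial.eval (fun i => z.1 i) q = 0 := by
      intro z
      have h1 := congrArg (fun v => inner ℂ e v) (hP z k)
      simp only [inner_sum, inner_smul_right, inner_zero_right] at h1
      rw [← h1, map_sum]
      refine Finset.sum_congr rfl fun β _ => ?_
      rw [MvPolynomial.eval_monomial, Finsupp.prod_fintype _ _ (fun i => pow_zero _)]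
      simp only [weight, mono, Finsupp.equivFunOnFinite_symm_apply_apply]
      ring
    have hq : q = 0 := by
      refine MvPolynomial.funext_set (fun _ : Fin n => Metric.ball (0 : ℂ) (1 / (n + 1))) ?_ ?_
      · intro i
        exact infinite_of_mem_nhds 0 (Metric.ball_mem_nhds _ (by positivity))
      · intro x hx
        have hx' : ∀ i, ‖x i‖ < 1 / (n + 1) := fun i => by simpa using hx i (Set.mem_univ i)
        have hxb : WithLp.toLp 2 x ∈ Metric.ball (0 : EuclideanSpace ℂ (Fin n)) 1 := by
          rw [mem_ball_zero_iff, EuclideanSpace.norm_eq, Real.sqrt_lt' one_pos]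
          calc ∑ i, ‖x i‖ ^ 2 ≤ ∑ _i : Fin n, (1 / ((n : ℝ) + 1)) ^ 2 :=
                Finset.sum_le_sum fun i _ => by have := hx' i; gcongr
            _ = n / ((n : ℝ) + 1) ^ 2 := by simp; ring
            _ < 1 ^ 2 := by
              rw [one_pow, div_lt_one (by positivity)]
              nlinarith [Nat.cast_nonneg (α := ℝ) n]
        simpa using hev ⟨_, hxb⟩
    have hc := congrArg (MvPolynomial.coeff (Finsupp.equivFunOnFinite.symm α)) hq
    simp only [q, MvPolynomial.coeff_sum, MvPolynomial.coeff_monomial,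
      EmbeddingLike.apply_eq_iff_eq, MvPolynomial.coeff_zero] at hc
    rw [Finset.sum_ite_eq' , if_pos (by simp [hk, len])] at hc
    have hr : (√(rho m α) : ℂ) ≠ 0 := by
      exact_mod_cast (Real.sqrt_pos.2 (rho_pos m α)).ne'
    simpa [hr] using hc
  exact lp.ext (funext key)

instance HmBall.instRKHS : RKHS ℂ (HmBall m n E) (Ball n) E where
  coeCLM := ContinuousLinearMap.pi fun z => HmBall.evalCLM z
  coeCLM_injective := by
    refine (injective_iff_map_eq_zero _).2 fun f hf => ?_
    exact HmBall.ncoeff_eq_zero f fun z => congrFun hf z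

lemma HmBall.apply_eq (f : HmBall m n E) (z : Ball n) :
    f z = ∑' α, ((√(rho m α) : ℂ) * mono z.1 α) • f.ncoeff α := rfl

lemma HmBall.norm_sq_eq (f : HmBall m n E) :
    HasSum (fun α => ‖f.ncoeff α‖ ^ 2) (‖f‖ ^ 2) := by
  have h := lp.hasSum_norm (by norm_num) (show lp (fun _ : Fin n → ℕ => E) 2 from f)
  simp only [ENNReal.toReal_ofNat, Real.rpow_ofNat] at h
  exact h

lemma HmBall.inner_eq (f g : HmBall m n E) :
    HasSum (fun α => inner ℂ (f.ncoeff α) (g.ncoeff α)) (inner ℂ f g) :=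
  lp.hasSum_inner (show lp (fun _ : Fin n → ℕ => E) 2 from f)
    (show lp (fun _ : Fin n → ℕ => E) 2 from g)

lemma len_add_single (α : Fin n → ℕ) (i : Fin n) : len (α + Pi.single i 1) = len α + 1 := by
  simp [len, Finset.sum_add_distrib]

lemma mono_add_single {R : Type*} [CommMonoid R] (z : Fin n → R) (α : Fin n → ℕ) (i : Fin n) :
    mono z (α + Pi.single i 1) = z i * mono z α := by
  simp only [mono, Pi.add_apply, pow_add, Finset.prod_mul_distrib]
  rw [mul_comm]
  congr 1
  rw [Finset.prod_eq_single i]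
  · simp
  · intro j _ hj
    simp [Pi.single_eq_of_ne hj]
  · simp

lemma rho_add_single (m : ℕ) [NeZero m] (α : Fin n → ℕ) (i : Fin n) :
    rho m (α + Pi.single i 1) * (α i + 1) = rho m α * (m + len α) := by
  have h1 : ∏ j, ((α + Pi.single i 1 : Fin n → ℕ) j)! = (∏ j, (α j)!) * (α i + 1) := by
    have hj : ∀ j, ((α + Pi.single i 1 : Fin n → ℕ) j)! =
        (α j)! * (if j = i then α i + 1 else 1) := by
      intro j
      by_cases h : j = i
      · subst h
        simp [Nat.factorial_succ, mul_comm]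
      · simp [h]
    rw [Finset.prod_congr rfl fun j _ => hj j, Finset.prod_mul_distrib]
    simp
  have h2 : m + len (α + Pi.single i 1) - 1 = (m + len α - 1) + 1 := by
    have := NeZero.one_le (n := m)
    rw [len_add_single]
    omega
  have h3 : ((m + len α - 1 : ℕ) : ℝ) + 1 = m + len α := by
    have := NeZero.one_le (n := m)
    have : m + len α - 1 + 1 = m + len α := by omega
    exact_mod_cast this
  have h4 : ((∏ j, (α j)! : ℕ) : ℝ) ≠ 0 := by
    exact_mod_cast Finset.prod_ne_zero_iff.2 fun i _ => Nat.factorial_ne_zero (α i)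
  have h5 : ((m - 1)! : ℝ) ≠ 0 := by exact_mod_cast Nat.factorial_ne_zero (m - 1)
  unfold rho
  rw [h1, h2, Nat.factorial_succ]
  push_cast at h4 ⊢
  rw [h3]
  have h6 : (α i : ℝ) + 1 ≠ 0 := by positivity
  field_simp

lemma rho_le_add_single (m : ℕ) [NeZero m] (α : Fin n → ℕ) (i : Fin n) :
    rho m α ≤ rho m (α + Pi.single i 1) := by
  have h := rho_add_single m α i
  have h1 : (α i : ℝ) + 1 ≤ m + len α := by
    have h2 : α i ≤ len α := Finset.single_le_sum (f := α) (fun _ _ => Nat.zero_le _)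
      (Finset.mem_univ i)
    have := NeZero.one_le (n := m)
    have : α i + 1 ≤ m + len α := by omega
    exact_mod_cast this
  have h3 := rho_pos m α
  have h4 : (0 : ℝ) < α i + 1 := by positivity
  nlinarith [mul_le_mul_of_nonneg_left h1 h3.le]

lemma HmBall.memlp_shift (f : HmBall m n E) (i : Fin n) :
    Memℓp (fun α => ((√(rho m α / rho m (α + Pi.single i 1)) : ℝ) : ℂ) •
      f.ncoeff (α + Pi.single i 1)) 2 ∧
    ∑' α, ‖((√(rho m α / rho m (α + Pi.single i 1)) : ℝ) : ℂ) •
      f.ncoeff (α + Pi.single i 1)‖ ^ 2 ≤ ‖f‖ ^ 2 := by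
  have hinj : Function.Injective fun α : Fin n → ℕ => α + Pi.single i 1 :=
    add_left_injective _
  have hs := (HmBall.norm_sq_eq f).summable
  have hs1 : Summable fun α => ‖f.ncoeff (α + Pi.single i 1)‖ ^ 2 := hs.comp_injective hinj
  have hle : ∀ α, ‖((√(rho m α / rho m (α + Pi.single i 1)) : ℝ) : ℂ) •
      f.ncoeff (α + Pi.single i 1)‖ ^ 2 ≤ ‖f.ncoeff (α + Pi.single i 1)‖ ^ 2 := by
    intro α
    have h1 : √(rho m α / rho m (α + Pi.single i 1)) ≤ 1 :=
      Real.sqrt_le_one.2 ((div_le_one (rho_pos _ _)).2 (rho_le_add_single m α i))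
    rw [norm_smul, Complex.norm_real, Real.norm_of_nonneg (Real.sqrt_nonneg _)]
    have := mul_le_of_le_one_left (norm_nonneg (f.ncoeff (α + Pi.single i 1))) h1
    gcongr
  have hs2 := Summable.of_nonneg_of_le (fun α => by positivity) hle hs1
  refine ⟨memℓp_gen (by simpa only [ENNReal.toReal_ofNat, Real.rpow_ofNat] using hs2), ?_⟩
  calc _ ≤ ∑' α, ‖f.ncoeff (α + Pi.single i 1)‖ ^ 2 := hs2.tsum_le_tsum hle hs1
    _ ≤ ∑' α, ‖f.ncoeff α‖ ^ 2 := tsum_comp_le_tsum_of_inj hs (fun α => by positivity) hinj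
    _ = ‖f‖ ^ 2 := (HmBall.norm_sq_eq f).tsum_eq

/-- The backward weighted shift
`(S_i x)(α) = (ρ_m(α) / ρ_m(α + e_i)) ^ (1/2) x(α + e_i)`. -/
def HmBall.backwardShift (i : Fin n) : HmBall m n E →L[ℂ] HmBall m n E :=
  LinearMap.mkContinuous
    { toFun := fun f => (⟨fun α => ((√(rho m α / rho m (α + Pi.single i 1)) : ℝ) : ℂ) •
        f.ncoeff (α + Pi.single i 1), (HmBall.memlp_shift f i).1⟩ :
        lp (fun _ : Fin n → ℕ => E) 2)
      map_add' := fun f g => lp.ext (funext fun α => smul_add _ _ _)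
      map_smul' := fun c f => lp.ext (funext fun α => smul_comm _ _ _) }
    1 (fun f => by
      rw [one_mul]
      refine le_of_sq_le_sq ?_ (norm_nonneg _)
      rw [← (HmBall.norm_sq_eq (m := m) (n := n) _).tsum_eq]
      exact (HmBall.memlp_shift f i).2)

lemma HmBall.backwardShift_ncoeff (i : Fin n) (f : HmBall m n E) (α : Fin n → ℕ) :
    (HmBall.backwardShift i f).ncoeff α =
      ((√(rho m α / rho m (α + Pi.single i 1)) : ℝ) : ℂ) • f.ncoeff (α + Pi.single i 1) := rfl

/-- The multiplication operator `M_{z_i}` on `H_m(𝔹, E)`, as the adjoint of the backward shift;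
`HmBall.mulCoord_apply` below shows that it is multiplication by the coordinate `z_i`. -/
def HmBall.mulCoord (i : Fin n) : HmBall m n E →L[ℂ] HmBall m n E :=
  ContinuousLinearMap.adjoint (HmBall.backwardShift i)

lemma HmBall.kerFun_ncoeff (z : Ball n) (v : E) (α : Fin n → ℕ) :
    (RKHS.kerFun (HmBall m n E) z v).ncoeff α = star (weight m z α) • v := by
  classical
  refine ext_inner_left ℂ fun e => ?_
  let g : HmBall m n E := (lp.single 2 α e : lp (fun _ : Fin n → ℕ => E) 2)
  have hg : ∀ β, β ≠ α → g.ncoeff β = 0 := fun β hβ => by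
    simp [g, HmBall.ncoeff, lp.single_apply, hβ]
  have hg' : g.ncoeff α = e := by simp [g, HmBall.ncoeff, lp.single_apply]
  have h1 : inner ℂ g (RKHS.kerFun (HmBall m n E) z v) = inner ℂ (g z) v :=
    RKHS.inner_kerFun z v g
  have h2 := (HmBall.inner_eq g (RKHS.kerFun (HmBall m n E) z v)).unique
    (hasSum_single α fun β hβ => by rw [hg β hβ, inner_zero_left])
  have h3 : g z = weight m z α • e :=
    (HmBall.hasSum_eval z g).unique
      (by
        have := hasSum_single (f := fun β => weight m z β • g.ncoeff β) α
          fun β hβ => by rw [hg β hβ, smul_zero]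
        rwa [hg'] at this)
  rw [h2, hg', h3, inner_smul_left] at h1
  rw [h1, inner_smul_right]
  rfl

/-- The operators `M_{z_i}` act as multiplication by the coordinates. -/
theorem HmBall.mulCoord_apply (i : Fin n) (f : HmBall m n E) (z : Ball n) :
    HmBall.mulCoord i f z = z.1 i • f z := by
  refine ext_inner_left ℂ fun v => ?_
  rw [← RKHS.kerFun_inner, HmBall.mulCoord, ContinuousLinearMap.adjoint_inner_right]
  have : HmBall.backwardShift i (RKHS.kerFun (HmBall m n E) z v) =
      star (z.1 i) • RKHS.kerFun (HmBall m n E) z v := by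
    refine lp.ext (funext fun α => ?_)
    change (HmBall.backwardShift i (RKHS.kerFun (HmBall m n E) z v)).ncoeff α =
      star (z.1 i) • (RKHS.kerFun (HmBall m n E) z v).ncoeff α
    rw [HmBall.backwardShift_ncoeff, HmBall.kerFun_ncoeff, HmBall.kerFun_ncoeff, smul_smul,
      smul_smul]
    congr 1
    simp only [weight, mono_add_single, star_mul', Complex.star_def, Complex.conj_ofReal]
    rw [← mul_assoc, ← Complex.ofReal_mul, ← Real.sqrt_mul (by
      exact div_nonneg (rho_pos _ _).le (rho_pos _ _).le), div_mul_cancel₀ _ (rho_pos _ _).ne']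
    ring
  rw [this, inner_smul_left, RKHS.kerFun_inner, inner_smul_right]
  simp

/-- The reproducing kernel of `H_m(𝔹, E)` is `K_m(z, w) = (1 - ⟨z, w⟩) ^ (-m) 1_E`, where
`⟨z, w⟩ = ∑ z_i conj(w_i)` is `inner ℂ w z`. -/
theorem HmBall.kernel_eq (z w : Ball n) :
    RKHS.kernel (HmBall m n E) z w =
      (((1 - inner ℂ w.1 z.1) ^ m)⁻¹ : ℂ) • ContinuousLinearMap.id ℂ E := by
  ext v
  rw [← RKHS.kerFun_apply]
  have h := HmBall.hasSum_eval z (RKHS.kerFun (HmBall m n E) w v)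
  have hx : ∑ i, ‖z.1 i * star (w.1 i)‖ < 1 := by
    have h1 := ball_sum_lt z
    have h2 := ball_sum_lt w
    have h3 : ∑ i, ‖z.1 i * star (w.1 i)‖ ≤ ∑ i, (‖z.1 i‖ ^ 2 + ‖w.1 i‖ ^ 2) / 2 := by
      refine Finset.sum_le_sum fun i _ => ?_
      rw [norm_mul, norm_star]
      nlinarith [sq_nonneg (‖z.1 i‖ - ‖w.1 i‖)]
    rw [← Finset.sum_div, Finset.sum_add_distrib] at h3
    linarith
  have h4 := (hasSum_rho m (fun i => z.1 i * star (w.1 i)) hx).smul_const v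
  refine h.unique ?_
  have h5 : inner ℂ w.1 z.1 = ∑ i, z.1 i * star (w.1 i) := by
    simp [PiLp.inner_apply]
  rw [h5]
  refine h4.congr_fun fun α => ?_
  rw [HmBall.kerFun_ncoeff, smul_smul]
  congr 1
  simp only [weight, mono, star_mul', Complex.star_def, Complex.conj_ofReal, map_prod, map_pow,
    mul_pow, Finset.prod_mul_distrib]
  have : ((rho m α : ℝ) : ℂ) = (√(rho m α) : ℂ) * (√(rho m α) : ℂ) := by
    rw [← Complex.ofReal_mul, Real.mul_self_sqrt (rho_pos m α).le]
  rw [this]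
  ring

end Space

section Tuples

open ContinuousLinearMap

/-- The ordered product `T_1 ^ α_1 ⋯ T_n ^ α_n`, that is `T ^ α` for a commuting tuple `T`. -/
def tuplePow {R : Type*} [Monoid R] (T : Fin n → R) (α : Fin n → ℕ) : R :=
  (List.ofFn fun i => T i ^ α i).prod

variable {H : Type*} [NormedAddCommGroup H] [InnerProductSpace ℂ H] [CompleteSpace H]

/-- The map `σ_T(X) = ∑ T_i X T_i^*`. -/
def sigma (T : Fin n → H →L[ℂ] H) : (H →L[ℂ] H) →ₗ[ℂ] (H →L[ℂ] H) where
  toFun X := ∑ i, T i ∘L X ∘L adjoint (T i)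
  map_add' X Y := by
    simp [ContinuousLinearMap.add_comp, ContinuousLinearMap.comp_add, Finset.sum_add_distrib]
  map_smul' c X := by
    simp [ContinuousLinearMap.smul_comp, Finset.smul_sum]

/-- The defect operator `Δ_T^{(k)} = (1 - σ_T)^k (1_H)`. -/
def defect (T : Fin n → H →L[ℂ] H) (k : ℕ) : H →L[ℂ] H :=
  ((1 - sigma T) ^ k) (ContinuousLinearMap.id ℂ H)

/-- A commuting tuple `T` is an `m`-hypercontraction if `Δ_T^{(1)} ≥ 0` and `Δ_T^{(m)} ≥ 0`. -/
structure IsHypercontraction (m : ℕ) (T : Fin n → H →L[ℂ] H) : Prop where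
  commute : ∀ i j, Commute (T i) (T j)
  defect_one_nonneg : (defect T 1).IsPositive
  defect_nonneg : (defect T m).IsPositive

/-- `T` is pure (of class `C_{·0}`) if `σ_T^k(1_H) → 0` in the strong operator topology. -/
def IsPure (T : Fin n → H →L[ℂ] H) : Prop :=
  ∀ x : H, Tendsto (fun k : ℕ => ((sigma T ^ k) (ContinuousLinearMap.id ℂ H)) x) atTop (𝓝 0)

/-- The column operator `T^* : H → H^n`, `h ↦ (T_i^* h)_i`. -/
def adjCol (T : Fin n → H →L[ℂ] H) : H →L[ℂ] PiLp 2 (fun _ : Fin n => H) :=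
  (PiLp.continuousLinearEquiv 2 ℂ (fun _ : Fin n => H)).symm.toContinuousLinearMap ∘L
    ContinuousLinearMap.pi fun i => adjoint (T i)

/-- The row operator `Z : H^n → H`, `(h_i) ↦ ∑ z_i h_i`. -/
def rowZ (H : Type*) [NormedAddCommGroup H] [InnerProductSpace ℂ H]
    (z : EuclideanSpace ℂ (Fin n)) : PiLp 2 (fun _ : Fin n => H) →L[ℂ] H :=
  ∑ i, z i • PiLp.proj 2 (fun _ : Fin n => H) i

/-- The direct sum `⊕ X : H^n → H^n`, `(h_i) ↦ (X h_i)`. -/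
def directSum (n : ℕ) (X : H →L[ℂ] H) :
    PiLp 2 (fun _ : Fin n => H) →L[ℂ] PiLp 2 (fun _ : Fin n => H) :=
  (PiLp.continuousLinearEquiv 2 ℂ (fun _ : Fin n => H)).symm.toContinuousLinearMap ∘L
    ContinuousLinearMap.pi fun i => X ∘L PiLp.proj 2 (fun _ : Fin n => H) i

/-- The operator `(1_H - Z T^*)⁻¹`, a genuine inverse whenever `1_H - Z T^*` is invertible, which
is the case for `z` in the ball and `T` a row contraction. -/
def resolventZT (T : Fin n → H →L[ℂ] H) (z : EuclideanSpace ℂ (Fin n)) : H →L[ℂ] H :=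
  Ring.inverse (ContinuousLinearMap.id ℂ H - rowZ H z ∘L adjCol T)

end Tuples

section Inner

open ContinuousLinearMap

variable {E : Type*} [NormedAddCommGroup E] [InnerProductSpace ℂ E] [CompleteSpace E]

/-- The function `j_C x = ∑ ρ_m(α) (C T^{*α} x) z ^ α` on the ball. -/
def dilation {H : Type*} [NormedAddCommGroup H] [InnerProductSpace ℂ H] [CompleteSpace H]
    (m : ℕ) (T : Fin n → H →L[ℂ] H) (C : H →L[ℂ] E) (x : H) : Ball n → E :=
  fun z => ∑' α : Fin n → ℕ,
    ((rho m α : ℂ) * mono z.1 α) • C (tuplePow (fun i => adjoint (T i)) α x)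

/-- `W` is `K_m`-inner: it is analytic on the ball, `x ↦ W x` is an isometry `V` into
`H_m(𝔹, E)`, and the range of `V` is orthogonal to its image under `M_z ^ α` for all `α ≠ 0`. -/
def IsKmInner {E' : Type*} [NormedAddCommGroup E'] [InnerProductSpace ℂ E']
    (m : ℕ) [NeZero m] (W : EuclideanSpace ℂ (Fin n) → E' →L[ℂ] E) : Prop :=
  AnalyticOnNhd ℂ W (Metric.ball 0 1) ∧
    ∃ V : E' →ₗᵢ[ℂ] HmBall m n E, (∀ (x : E') (z : Ball n), V x z = W z x) ∧
      ∀ α : Fin n → ℕ, α ≠ 0 → ∀ x y : E',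
        inner ℂ (tuplePow HmBall.mulCoord α (V y)) (V x) = 0

end Inner

end BallSpace

end

open BallSpace

namespace BallSpace

set_option linter.unusedSectionVars false

open Filter Topology ContinuousLinearMap
open scoped Nat

/-! ### Iterated differences of null sequences -/

/-! Write `Y = ∑_{k<m} Δ_T^{(k)}`, `J = j_C`, and let `Δ` be the diagonal operator on `H_m(𝔹, E)`
multiplying the degree-`k` part by `(m + k) / (k + 1)`. Everything rests on three facts.

(a) For fixed `x` put `a_j(N) = ⟨σ_T^N(Δ_T^{(j)}) x, x⟩`. Then `a_{j+1}(N) = a_j(N) - a_j(N+1)`, and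
purity makes each `a_j` a null sequence. Since `Δ_T^{(m)} = C^*C`, `a_m(k)` is the multinomially
weighted sum of `‖C T^{*α} x‖²` over `|α| = k`, hence nonnegative. Repeated telescoping recovers all
lower `a_j(0)` as binomial series in `a_m` (`hasSum_choose_mul_difference`). The lowest one says
that `J` is isometric; adding all of them gives `J^* Δ J = Y` (`inner_dilationCLM_diag`). Moreover
`M_{z_i}^* J = J T_i^*`.

(b) `∑ M_{z_i} Δ M_{z_i}^*` is the projection onto the complement of the constants
(`sum_mulCoord_diag_backwardShift`).

(c) Comparing power series, `C ∑_{k=1}^m (1 - Z T^*)^{-k} b = (Δ J b)(z)` (`diag_dilationCLM_eval`),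
so `V x = W x` equals `D x + ∑ M_{z_i} Δ J (B x)_i`.

By (KI4), `J (B x)_i = M_{z_i}^* f`, so (b) gives `V x = D x + f - f(0)` and therefore `M_{z_i}^* V
x = J (B x)_i`. With `J^* Δ J = Y`, (KI3) becomes `‖V x‖ = ‖x‖` and (KI2) becomes `ran J ⟂ ran V`.
Orthogonality follows: for `α = β + e_i`, `M_z^{*α} V x = J T^{*β} (B x)_i` lies in `ran J`. -/

lemma hasSum_sub_succ_of_nonneg {b : ℕ → ℝ} (h0 : Tendsto b atTop (𝓝 0))
    (hb : ∀ N, 0 ≤ b N - b (N + 1)) (N : ℕ) :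
    HasSum (fun k => b (N + k) - b (N + k + 1)) (b N) := by
  rw [hasSum_iff_tendsto_nat_of_nonneg fun k => hb _]
  have h : ∀ M, ∑ k ∈ Finset.range M, (b (N + k) - b (N + k + 1)) = b N - b (N + M) :=
    fun M => by simpa [add_assoc] using Finset.sum_range_sub' (fun k => b (N + k)) M
  simp only [h]
  have h1 : Tendsto (fun M => b (N + M)) atTop (𝓝 0) :=
    h0.comp (tendsto_atTop_mono (fun M => Nat.le_add_left M N) tendsto_id)
  simpa using h1.const_sub (b N)

/-- Tonelli: in the nonnegative double series `∑_l ∑_i c_i b_{l+i}`, the antidiagonal `l + i = k`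
collects `b_k` once with each `c_i`, `i ≤ k`. With binomial `c` this raises the order of summation
by one. -/
lemma hasSum_range_sum_mul {c b : ℕ → ℝ} {b' : ℕ → ℝ} {s : ℝ} (hc : ∀ k, 0 ≤ c k)
    (hb : ∀ k, 0 ≤ b k) (h1 : ∀ l, HasSum (fun k => c k * b (l + k)) (b' l)) (h2 : HasSum b' s) :
    HasSum (fun k => (∑ i ∈ Finset.range (k + 1), c i) * b k) s := by
  have hsum : Summable fun p : ℕ × ℕ => c p.2 * b (p.1 + p.2) := by
    rw [summable_prod_of_nonneg fun p => mul_nonneg (hc _) (hb _)]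
    refine ⟨fun l => (h1 l).summable, ?_⟩
    simpa only [fun l => (h1 l).tsum_eq] using h2.summable
  have hs : HasSum (fun p : ℕ × ℕ => c p.2 * b (p.1 + p.2)) s := by
    have := hsum.hasSum
    rwa [(this.prod_fiberwise h1).unique h2] at this
  have h3 := (Finset.HasAntidiagonal.sigmaAntidiagonalEquivProd (A := ℕ)).hasSum_iff.2 hs
  refine h3.sigma fun k => ?_
  have h4 : (∑ i ∈ Finset.range (k + 1), c i) * b k =
      ∑ p : {p : ℕ × ℕ // p ∈ Finset.HasAntidiagonal.antidiagonal k}, c p.1.2 * b (p.1.1 + p.1.2) := by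
    rw [Finset.sum_coe_sort (Finset.HasAntidiagonal.antidiagonal k) fun p : ℕ × ℕ => c p.2 * b (p.1 + p.2),
      Finset.sum_mul, ← Finset.Nat.sum_antidiagonal_eq_sum_range_succ_mk
        (fun p : ℕ × ℕ => c p.1 * b k), ← Finset.Nat.sum_antidiagonal_swap]
    refine Finset.sum_congr rfl fun p hp => ?_
    rw [Finset.HasAntidiagonal.mem_antidiagonal.1 hp]
    rfl
  rw [h4]
  exact hasSum_fintype _

/-- If `a j` is the `j`-th iterated backward difference of a null sequence and `a m ≥ 0`, then the
lower differences are recovered by summation against binomial coefficients. -/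
lemma hasSum_choose_mul_difference {a : ℕ → ℕ → ℝ} {m : ℕ} (hm : ∀ N, 0 ≤ a m N)
    (ha : ∀ j N, a (j + 1) N = a j N - a j (N + 1)) (h0 : ∀ j, Tendsto (a j) atTop (𝓝 0)) :
    ∀ j, j < m → ∀ N,
      HasSum (fun k => ((k + j).choose j : ℝ) * a m (N + k)) (a (m - (j + 1)) N) := by
  intro j
  induction j with
  | zero =>
    intro hj N
    have hm1 : m = m - 1 + 1 := by omega
    have h1 : ∀ N, a m N = a (m - 1) N - a (m - 1) (N + 1) := fun N => by
      conv_lhs => rw [hm1]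
      exact ha _ _
    have := hasSum_sub_succ_of_nonneg (h0 (m - 1)) (fun N => by rw [← h1]; exact hm N) N
    simpa [h1] using this
  | succ j ih =>
    intro hj N
    have hj' : j < m := by omega
    have hm1 : m - (j + 1) = m - (j + 1 + 1) + 1 := by omega
    have h1 : ∀ N, a (m - (j + 1)) N =
        a (m - (j + 1 + 1)) N - a (m - (j + 1 + 1)) (N + 1) := fun N => by
      rw [hm1]
      exact ha _ _
    -- Only `a m` is assumed nonnegative; the sign of each lower difference comes from its series
    -- representation, and is what permits telescoping once more.
    have hpos : ∀ N, 0 ≤ a (m - (j + 1)) N := fun N =>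
      (ih hj' N).nonneg fun k => mul_nonneg (Nat.cast_nonneg _) (hm _)
    have h2 := hasSum_sub_succ_of_nonneg (h0 (m - (j + 1 + 1)))
      (fun N => by rw [← h1]; exact hpos N) N
    simp only [← h1] at h2
    have h3 := hasSum_range_sum_mul (c := fun k => ((k + j).choose j : ℝ))
      (b := fun k => a m (N + k)) (fun k => Nat.cast_nonneg _) (fun k => hm _)
      (fun l => by simpa only [add_assoc] using ih hj' (N + l)) h2
    refine h3.congr_fun fun k => ?_
    -- Hockey-stick identity: `∑_{i ≤ k} C(i + j, j) = C(k + j + 1, j + 1)`.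
    rw [← Nat.cast_sum, Nat.sum_range_add_choose]
    congr 2

/-! ### Powers of commuting tuples -/

section Monoid

variable {n : ℕ} {R : Type*}

/-- Passing from an ordered list to an order-free product allows a single factor to be split off and
matches the noncommutative multinomial theorem. -/
lemma tuplePow_eq_noncommProd [Monoid R] (S : Fin n → R) (α : Fin n → ℕ)
    (comm : (↑(Finset.univ : Finset (Fin n)) : Set (Fin n)).Pairwise
      (Function.onFun Commute fun i => S i ^ α i)) :
    tuplePow S α = Finset.univ.noncommProd (fun i => S i ^ α i) comm := by
  have h : (Finset.univ : Finset (Fin n)) = (List.finRange n).toFinset := by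
    ext i; simp
  rw [tuplePow, List.ofFn_eq_map, Finset.noncommProd_congr h (fun _ _ => rfl) comm]
  exact (Finset.noncommProd_toFinset _ _ (h ▸ comm) (List.nodup_finRange n)).symm

lemma pairwise_commute_pow [Monoid R] {S : Fin n → R} (hS : ∀ i j, Commute (S i) (S j))
    (α : Fin n → ℕ) (s : Set (Fin n)) :
    s.Pairwise (Function.onFun Commute fun i => S i ^ α i) :=
  fun i _ j _ _ => (hS i j).pow_pow _ _

lemma tuplePow_add_single [Monoid R] {S : Fin n → R} (hS : ∀ i j, Commute (S i) (S j))
    (α : Fin n → ℕ) (i : Fin n) :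
    tuplePow S (α + Pi.single i 1) = tuplePow S α * S i := by
  rw [tuplePow_eq_noncommProd S _ (pairwise_commute_pow hS _ _),
    tuplePow_eq_noncommProd S _ (pairwise_commute_pow hS _ _),
    ← Finset.noncommProd_erase_mul _ (Finset.mem_univ i),
    ← Finset.noncommProd_erase_mul _ (Finset.mem_univ i), mul_assoc]
  congr 1
  · refine Finset.noncommProd_congr rfl (fun j hj => ?_) _
    simp [Finset.ne_of_mem_erase hj]
  · simp [pow_succ]

lemma map_tuplePow {R' : Type*} [Monoid R] [Monoid R'] (f : R →* R') (S : Fin n → R)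
    (α : Fin n → ℕ) : f (tuplePow S α) = tuplePow (fun i => f (S i)) α := by
  simp [tuplePow, map_list_prod, List.map_ofFn, Function.comp_def]

lemma star_tuplePow [Monoid R] [StarMul R] {S : Fin n → R} (hS : ∀ i j, Commute (S i) (S j))
    (α : Fin n → ℕ) : star (tuplePow S α) = tuplePow (fun i => star (S i)) α := by
  classical
  have hS' : ∀ i j, Commute (star (S i)) (star (S j)) := fun i j => (hS i j).star_star
  have key : ∀ s : Finset (Fin n),
      star (s.noncommProd (fun i => S i ^ α i) (pairwise_commute_pow hS _ _)) =
        s.noncommProd (fun i => star (S i) ^ α i) (pairwise_commute_pow hS' _ _) := by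
    intro s
    induction s using Finset.induction_on with
    | empty => simp
    | insert i s hi ih =>
      -- The star reverses products, so the new factor is split off on the left on one side and on
      -- the right on the other.
      rw [Finset.noncommProd_insert_of_notMem _ _ _ _ hi,
        Finset.noncommProd_insert_of_notMem' _ _ _ _ hi, star_mul, ih, star_pow]
  rw [tuplePow_eq_noncommProd S _ (pairwise_commute_pow hS _ _), key,
    tuplePow_eq_noncommProd _ _ (pairwise_commute_pow hS' _ _)]

lemma sum_pow_eq_sum_tuplePow [Semiring R] {S : Fin n → R} (hS : ∀ i j, Commute (S i) (S j))
    (k : ℕ) :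
    (∑ i, S i) ^ k = ∑ α ∈ Finset.piAntidiag Finset.univ k,
      (Nat.multinomial Finset.univ α : R) * tuplePow S α := by
  rw [Finset.sum_pow_eq_sum_piAntidiag_of_commute _ _ fun i _ j _ _ => hS i j]
  exact Finset.sum_congr rfl fun α _ => by
    rw [tuplePow_eq_noncommProd S _ (pairwise_commute_pow hS _ _)]

lemma tuplePow_smul {A : Type*} [Monoid A] [CommMonoid R] [MulAction R A] [IsScalarTower R A A]
    [SMulCommClass R A A] (z : Fin n → R) (S : Fin n → A) (α : Fin n → ℕ) :
    tuplePow (fun i => z i • S i) α = mono z α • tuplePow S α := by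
  induction n with
  | zero => simp [tuplePow, mono]
  | succ n ih =>
    have := ih (fun i => z i.succ) (fun i => S i.succ) (fun i => α i.succ)
    simp only [tuplePow, mono, List.ofFn_succ, List.prod_cons, Fin.prod_univ_succ] at this ⊢
    rw [this, smul_pow, smul_mul_smul_comm]

end Monoid

/-! ### Operator tuples -/

section Operators

variable {n : ℕ} {H : Type*} [NormedAddCommGroup H] [InnerProductSpace ℂ H] [CompleteSpace H]
variable {E : Type*} [NormedAddCommGroup E] [InnerProductSpace ℂ E] [CompleteSpace E]

/-- Conjugation `A ↦ (X ↦ A X A^*)`. -/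
noncomputable def conjHom (H : Type*) [NormedAddCommGroup H] [InnerProductSpace ℂ H] [CompleteSpace H] :
    (H →L[ℂ] H) →* Module.End ℂ (H →L[ℂ] H) where
  toFun A :=
    { toFun := fun X => A * X * star A
      map_add' := fun X Y => by rw [mul_add, add_mul]
      map_smul' := fun c X => by simp }
  map_one' := by ext1 X; simp
  map_mul' A A' := by ext1 X; simp [mul_assoc]

lemma conjHom_apply (A X : H →L[ℂ] H) : conjHom H A X = A * X * star A := rfl

lemma sigma_eq_sum_conjHom (T : Fin n → H →L[ℂ] H) : sigma T = ∑ i, conjHom H (T i) := by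
  ext1 X
  simp [sigma, conjHom_apply, star_eq_adjoint, mul_def, ContinuousLinearMap.comp_assoc]

lemma commute_adjoint {T : Fin n → H →L[ℂ] H} (hT : ∀ i j, Commute (T i) (T j)) (i j : Fin n) :
    Commute (adjoint (T i)) (adjoint (T j)) :=
  (hT i j).star_star

/-- `σ_T` is a sum of the commuting conjugations `X ↦ T_i X T_i^*`, so the multinomial theorem
applies in the algebra of linear maps on operators. -/
lemma sigma_pow_apply {T : Fin n → H →L[ℂ] H} (hT : ∀ i j, Commute (T i) (T j)) (k : ℕ)
    (X : H →L[ℂ] H) :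
    (sigma T ^ k) X = ∑ α ∈ Finset.piAntidiag Finset.univ k,
      (Nat.multinomial Finset.univ α : ℂ) •
        (tuplePow T α * X * tuplePow (fun i => adjoint (T i)) α) := by
  rw [sigma_eq_sum_conjHom, sum_pow_eq_sum_tuplePow fun i j => (hT i j).map (conjHom H),
    LinearMap.sum_apply]
  refine Finset.sum_congr rfl fun α _ => ?_
  rw [← map_tuplePow (conjHom H), ← nsmul_eq_mul, LinearMap.smul_apply, conjHom_apply,
    star_tuplePow hT, Nat.cast_smul_eq_nsmul]
  rfl

lemma re_inner_sigma_pow_adjoint_comp {T : Fin n → H →L[ℂ] H} (hT : ∀ i j, Commute (T i) (T j))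
    (C : H →L[ℂ] E) (k : ℕ) (x : H) :
    (inner ℂ ((sigma T ^ k) (adjoint C ∘L C) x) x).re =
      ∑ α ∈ Finset.piAntidiag Finset.univ k, (Nat.multinomial Finset.univ α : ℝ) *
        ‖C (tuplePow (fun i => adjoint (T i)) α x)‖ ^ 2 := by
  rw [sigma_pow_apply hT, sum_apply, sum_inner, Complex.re_sum]
  refine Finset.sum_congr rfl fun α _ => ?_
  have h1 : adjoint (tuplePow T α) = tuplePow (fun i => adjoint (T i)) α := star_tuplePow hT α
  rw [smul_apply, inner_smul_left, mul_def, mul_def, comp_apply, comp_apply, ← adjoint_inner_right,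
    h1, comp_apply, adjoint_inner_left, inner_self_eq_norm_sq_to_K, Complex.conj_natCast]
  norm_cast
  rw [← Complex.ofReal_natCast, Complex.re_ofReal_mul]
  rfl

/-- Since `Δ_T^{(j+1)} = (1 - σ_T) Δ_T^{(j)}`, raising the defect order is a backward difference in
the power of `σ_T`. -/
lemma sigma_pow_defect_succ (T : Fin n → H →L[ℂ] H) (j N : ℕ) :
    (sigma T ^ N) (defect T (j + 1)) =
      (sigma T ^ N) (defect T j) - (sigma T ^ (N + 1)) (defect T j) := by
  rw [defect, defect, pow_succ' (1 - sigma T), Module.End.mul_apply, LinearMap.sub_apply,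
    map_sub, pow_succ (sigma T), Module.End.mul_apply, Module.End.one_apply]

lemma IsPure.tendsto_sigma_pow_defect {T : Fin n → H →L[ℂ] H} (hT : IsPure T) (j : ℕ) (x : H) :
    Tendsto (fun N => (sigma T ^ N) (defect T j) x) atTop (𝓝 0) := by
  induction j with
  | zero => simpa [defect] using hT x
  | succ j ih =>
    simp only [sigma_pow_defect_succ, sub_apply]
    simpa using ih.sub (ih.comp (tendsto_add_atTop_nat 1))

/-- If `T` is a pure commuting tuple and `C^* C = Δ_T^{(m)}`, the defect operators
`Δ_T^{(m - 1)}, …, Δ_T^{(0)} = 1` are recovered from `C`. -/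
lemma hasSum_choose_mul_norm_sq {m : ℕ} {T : Fin n → H →L[ℂ] H}
    (hT : ∀ i j, Commute (T i) (T j)) (hpure : IsPure T) {C : H →L[ℂ] E}
    (hC : adjoint C ∘L C = defect T m) {j : ℕ} (hj : j < m) (x : H) :
    HasSum (fun k => ((k + j).choose j : ℝ) *
      ∑ α ∈ Finset.piAntidiag Finset.univ k, (Nat.multinomial Finset.univ α : ℝ) *
        ‖C (tuplePow (fun i => adjoint (T i)) α x)‖ ^ 2)
      (inner ℂ (defect T (m - (j + 1)) x) x).re := by
  have key := fun k => re_inner_sigma_pow_adjoint_comp hT C k x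
  rw [hC] at key
  have h := hasSum_choose_mul_difference
    (a := fun j N => (inner ℂ ((sigma T ^ N) (defect T j) x) x).re) (m := m)
    (fun N => by
      rw [key]
      exact Finset.sum_nonneg fun α _ => by positivity)
    (fun j N => by rw [sigma_pow_defect_succ, sub_apply, inner_sub_left, Complex.sub_re])
    (fun j => by
      have h1 : Tendsto (fun N => inner ℂ ((sigma T ^ N) (defect T j) x) x) atTop
          -- Strong convergence suffices, since only the quadratic form at the fixed vector `x`
          -- enters.
          (𝓝 (inner ℂ 0 x)) := (hpure.tendsto_sigma_pow_defect j x).inner tendsto_const_nhds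
      simpa [Function.comp_def] using (Complex.continuous_re.tendsto _).comp h1) j hj 0
  simpa [key] using h

/-! ### Row and column operators and the resolvent on the ball -/

lemma directSum_apply (X : H →L[ℂ] H) (b : PiLp 2 (fun _ : Fin n => H)) (i : Fin n) :
    directSum n X b i = X (b i) := rfl

lemma adjCol_apply (T : Fin n → H →L[ℂ] H) (h : H) (i : Fin n) :
    adjCol T h i = adjoint (T i) h := rfl

lemma rowZ_apply (z : EuclideanSpace ℂ (Fin n)) (b : PiLp 2 (fun _ : Fin n => H)) :
    rowZ H z b = ∑ i, z i • b i := by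
  simp [rowZ]

lemma rowZ_comp_adjCol (T : Fin n → H →L[ℂ] H) (z : EuclideanSpace ℂ (Fin n)) :
    rowZ H z ∘L adjCol T = ∑ i, z i • adjoint (T i) := by
  ext h
  simp [rowZ_apply, adjCol_apply]

lemma norm_rowZ_le (z : EuclideanSpace ℂ (Fin n)) : ‖rowZ H z‖ ≤ ‖z‖ := by
  refine opNorm_le_bound _ (norm_nonneg _) fun b => ?_
  rw [rowZ_apply, EuclideanSpace.norm_eq, PiLp.norm_eq_of_L2]
  refine (norm_sum_le _ _).trans ?_
  simp only [norm_smul]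
  exact Real.sum_mul_le_sqrt_mul_sqrt _ _ _

/-- `Δ_T^{(1)} = 1 - ∑ T_i T_i^*` has quadratic form `‖h‖² - ‖T^* h‖²`. -/
lemma norm_adjCol_le {T : Fin n → H →L[ℂ] H} (hT : (defect T 1).IsPositive) :
    ‖adjCol T‖ ≤ 1 := by
  refine opNorm_le_bound _ zero_le_one fun h => ?_
  have h1 := hT.2 h
  have h2 : (inner ℂ (defect T 1 h) h).re = ‖h‖ ^ 2 - ‖adjCol T h‖ ^ 2 := by
    rw [PiLp.norm_sq_eq_of_L2]
    simp only [defect, sigma, pow_one, LinearMap.sub_apply, Module.End.one_apply, sub_apply,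
      id_apply, LinearMap.coe_mk, AddHom.coe_mk, sum_apply, comp_apply,
      inner_sub_left, sum_inner, ← adjoint_inner_right, Complex.sub_re, Complex.re_sum,
      adjCol_apply, inner_self_eq_norm_sq_to_K]
    norm_cast
  rw [reApplyInnerSelf_apply] at h1
  have h3 : 0 ≤ ‖h‖ ^ 2 - ‖adjCol T h‖ ^ 2 := h2 ▸ h1
  rw [one_mul]
  exact le_of_sq_le_sq (by linarith) (norm_nonneg _)

lemma norm_rowZ_comp_adjCol_lt_one {T : Fin n → H →L[ℂ] H} (hT : (defect T 1).IsPositive)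
    {z : EuclideanSpace ℂ (Fin n)} (hz : z ∈ Metric.ball (0 : EuclideanSpace ℂ (Fin n)) 1) :
    ‖rowZ H z ∘L adjCol T‖ < 1 :=
  calc ‖rowZ H z ∘L adjCol T‖ ≤ ‖rowZ H z‖ * ‖adjCol T‖ := opNorm_comp_le _ _
    _ ≤ ‖z‖ * 1 := mul_le_mul (norm_rowZ_le z) (norm_adjCol_le hT) (opNorm_nonneg _) (norm_nonneg _)
    _ < 1 := by simpa using hz

lemma rowZ_comp_adjCol_pow {T : Fin n → H →L[ℂ] H} (hT : ∀ i j, Commute (T i) (T j))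
    (z : EuclideanSpace ℂ (Fin n)) (k : ℕ) :
    (rowZ H z ∘L adjCol T) ^ k = ∑ α ∈ Finset.piAntidiag Finset.univ k,
      ((Nat.multinomial Finset.univ α : ℂ) * mono z α) •
        tuplePow (fun i => adjoint (T i)) α := by
  rw [rowZ_comp_adjCol, sum_pow_eq_sum_tuplePow fun i j =>
    ((commute_adjoint hT i j).smul_left _).smul_right _]
  refine Finset.sum_congr rfl fun α _ => ?_
  rw [tuplePow_smul, ← nsmul_eq_mul, ← Nat.cast_smul_eq_nsmul ℂ, smul_smul]

/-- Negative binomial series in the Banach algebra of operators, valid because `‖Z T^*‖ < 1` on the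
ball. -/
lemma hasSum_resolventZT_pow {T : Fin n → H →L[ℂ] H} (hT : (defect T 1).IsPositive)
    {z : EuclideanSpace ℂ (Fin n)} (hz : z ∈ Metric.ball (0 : EuclideanSpace ℂ (Fin n)) 1)
    (j : ℕ) :
    HasSum (fun k => ((k + j).choose j : ℂ) • (rowZ H z ∘L adjCol T) ^ k)
      (resolventZT T z ^ (j + 1)) := by
  have h := hasSum_choose_mul_geometric_of_norm_lt_one' j (norm_rowZ_comp_adjCol_lt_one hT hz)
  refine h.congr_fun fun k => ?_
  rw [Nat.cast_smul_eq_nsmul, nsmul_eq_mul]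

lemma analyticAt_resolventZT {T : Fin n → H →L[ℂ] H} (hT : (defect T 1).IsPositive)
    {z : EuclideanSpace ℂ (Fin n)} (hz : z ∈ Metric.ball (0 : EuclideanSpace ℂ (Fin n)) 1) :
    AnalyticAt ℂ (resolventZT T) z := by
  have h1 : AnalyticAt ℂ (fun w : EuclideanSpace ℂ (Fin n) =>
      ContinuousLinearMap.id ℂ H - rowZ H w ∘L adjCol T) z := by
    simp only [rowZ_comp_adjCol]
    refine analyticAt_const.sub (Finset.analyticAt_fun_sum _ fun i _ => ?_)
    exact ((EuclideanSpace.proj (𝕜 := ℂ) i).analyticAt z).smul analyticAt_const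
  have h2 := analyticAt_inverse (𝕜 := ℂ) (Units.oneSub _ (norm_rowZ_comp_adjCol_lt_one hT hz))
  rw [Units.val_oneSub] at h2
  exact AnalyticAt.comp (g := Ring.inverse) h2 h1

lemma analyticAt_rowZ_comp {E' : Type*} [NormedAddCommGroup E'] [InnerProductSpace ℂ E']
    (B : E' →L[ℂ] PiLp 2 (fun _ : Fin n => H)) (z : EuclideanSpace ℂ (Fin n)) :
    AnalyticAt ℂ (fun w => rowZ H w ∘L B) z := by
  have h : (fun w => rowZ H w ∘L B) = fun w : EuclideanSpace ℂ (Fin n) =>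
      ∑ i, w i • (PiLp.proj 2 (fun _ : Fin n => H) i ∘L B) := by
    ext w x
    simp [rowZ_apply]
  rw [h]
  refine Finset.analyticAt_fun_sum _ fun i _ => ?_
  exact ((EuclideanSpace.proj (𝕜 := ℂ) i).analyticAt z).smul analyticAt_const

end Operators

/-! ### The model space -/

section Model

variable {n m : ℕ} {E : Type*} [NormedAddCommGroup E] [InnerProductSpace ℂ E]
  [NeZero m] [CompleteSpace E]

namespace HmBall

lemma ext_ncoeff {f g : HmBall m n E} (h : ∀ α, f.ncoeff α = g.ncoeff α) : f = g :=
  lp.ext (funext h)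

lemma ncoeff_add (f g : HmBall m n E) (α : Fin n → ℕ) :
    (f + g).ncoeff α = f.ncoeff α + g.ncoeff α := rfl

lemma ncoeff_smul (c : ℂ) (f : HmBall m n E) (α : Fin n → ℕ) :
    (c • f).ncoeff α = c • f.ncoeff α := rfl

/-- The element with normalized coefficients `x α`. -/
noncomputable def ofNcoeff (m : ℕ) (x : (Fin n → ℕ) → E) (hx : Summable fun α => ‖x α‖ ^ 2) :
    HmBall m n E :=
  (⟨x, memℓp_gen (by simpa using hx)⟩ : lp (fun _ : Fin n → ℕ => E) 2)

lemma ncoeff_ofNcoeff (x : (Fin n → ℕ) → E) (hx : Summable fun α => ‖x α‖ ^ 2) :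
    (ofNcoeff m x hx).ncoeff = x := rfl

/-- The element `e z ^ α`, up to normalization. -/
noncomputable def single (m : ℕ) (α : Fin n → ℕ) (e : E) : HmBall m n E :=
  (lp.single 2 α e : lp (fun _ : Fin n → ℕ => E) 2)

lemma ncoeff_single (α β : Fin n → ℕ) (e : E) :
    (single m α e).ncoeff β = if β = α then e else 0 := by
  by_cases h : β = α
  · subst h
    simp [single, ncoeff, lp.single_apply]
  · simp [single, ncoeff, lp.single_apply, h]

lemma inner_single_left (α : Fin n → ℕ) (e : E) (f : HmBall m n E) :
    inner ℂ (single m α e) f = inner ℂ e (f.ncoeff α) := by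
  refine (inner_eq _ f).unique ?_
  convert hasSum_single α (fun β hβ => ?_) using 1
  · simp [ncoeff_single]
  · simp [ncoeff_single, hβ]

lemma norm_single (α : Fin n → ℕ) (e : E) : ‖single m α e‖ = ‖e‖ := by
  have h := inner_single_left (m := m) α e (single m α e)
  rw [ncoeff_single, if_pos rfl, inner_self_eq_norm_sq_to_K, inner_self_eq_norm_sq_to_K] at h
  have h' : ‖single m α e‖ ^ 2 = ‖e‖ ^ 2 := by exact_mod_cast h
  exact (sq_eq_sq₀ (norm_nonneg _) (norm_nonneg _)).1 h'

/-- The inclusion of `E` into `H_m(𝔹, E)` as constant functions. -/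
noncomputable def const (m n : ℕ) [NeZero m] (E : Type*) [NormedAddCommGroup E]
    [InnerProductSpace ℂ E] [CompleteSpace E] : E →L[ℂ] HmBall m n E :=
  LinearMap.mkContinuous
    { toFun := fun e => single m 0 e
      map_add' := fun e e' => ext_ncoeff fun α => by
        simp only [ncoeff_add, ncoeff_single]; split_ifs <;> simp
      map_smul' := fun c e => ext_ncoeff fun α => by
        simp only [RingHom.id_apply, ncoeff_smul, ncoeff_single]; split_ifs <;> simp }
    1 (fun e => by simp [norm_single])

lemma const_apply (e : E) : const m n E e = single m 0 e := rfl

/-- The factors `(m + |α|) / (|α| + 1)`. -/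
noncomputable def ratio (m : ℕ) (α : Fin n → ℕ) : ℝ := (m + len α) / (len α + 1)

lemma ratio_pos (m : ℕ) [NeZero m] (α : Fin n → ℕ) : 0 < ratio m α := by
  have := NeZero.pos m
  unfold ratio
  positivity

lemma ratio_le (m : ℕ) [NeZero m] (α : Fin n → ℕ) : ratio m α ≤ m := by
  have h : (1 : ℝ) ≤ m := by exact_mod_cast NeZero.one_le (n := m)
  rw [ratio, div_le_iff₀ (by positivity)]
  nlinarith [Nat.cast_nonneg (α := ℝ) (len α)]

lemma norm_ratio_smul_sq_le (f : HmBall m n E) (α : Fin n → ℕ) :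
    ‖((ratio m α : ℝ) : ℂ) • f.ncoeff α‖ ^ 2 ≤ (m : ℝ) ^ 2 * ‖f.ncoeff α‖ ^ 2 := by
  rw [norm_smul, mul_pow, Complex.norm_real, Real.norm_of_nonneg (ratio_pos m α).le]
  have := ratio_le m α
  have := (ratio_pos m α).le
  gcongr

lemma summable_norm_ratio_smul_sq (f : HmBall m n E) :
    Summable fun α => ‖((ratio m α : ℝ) : ℂ) • f.ncoeff α‖ ^ 2 :=
  ((norm_sq_eq f).summable.mul_left _).of_nonneg_of_le (fun α => by positivity)
    (norm_ratio_smul_sq_le f)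

/-- The diagonal operator `f ↦ ∑ (m + |α|) / (|α| + 1) f_α z ^ α`. -/
noncomputable def diag (m n : ℕ) [NeZero m] (E : Type*) [NormedAddCommGroup E]
    [InnerProductSpace ℂ E] [CompleteSpace E] : HmBall m n E →L[ℂ] HmBall m n E :=
  LinearMap.mkContinuous
    { toFun := fun f => ofNcoeff m (fun α => ((ratio m α : ℝ) : ℂ) • f.ncoeff α)
        (summable_norm_ratio_smul_sq f)
      map_add' := fun f g => ext_ncoeff fun α => smul_add _ _ _
      map_smul' := fun c f => ext_ncoeff fun α => smul_comm _ _ _ }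
    m (fun f => by
      refine le_of_sq_le_sq ?_ (by positivity)
      rw [mul_pow]
      refine hasSum_le (norm_ratio_smul_sq_le f) ?_ ((norm_sq_eq f).mul_left _)
      exact norm_sq_eq (ofNcoeff m _ (summable_norm_ratio_smul_sq f)))

lemma diag_ncoeff (f : HmBall m n E) (α : Fin n → ℕ) :
    (diag m n E f).ncoeff α = ((ratio m α : ℝ) : ℂ) • f.ncoeff α := rfl

/-! ### Adjoint shifts and the projection off the constants -/

lemma adjoint_mulCoord (i : Fin n) :
    adjoint (mulCoord (m := m) (E := E) i) = backwardShift i :=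
  adjoint_adjoint _

lemma eval_eq_tsum (f : HmBall m n E) (z : Ball n) :
    HasSum (fun α => ((√(rho m α) : ℂ) * mono z.1 α) • f.ncoeff α) (f z) :=
  hasSum_eval z f

lemma const_eval (e : E) (z : Ball n) : const m n E e z = e := by
  refine (eval_eq_tsum _ z).unique ?_
  convert hasSum_single (0 : Fin n → ℕ) (fun β hβ => ?_) using 1
  · simp [const_apply, ncoeff_single, mono, rho, len, Nat.factorial_ne_zero]
  · simp [const_apply, ncoeff_single, hβ]

lemma backwardShift_const (i : Fin n) (e : E) : backwardShift i (const m n E e) = 0 := by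
  refine ext_ncoeff fun α => ?_
  have h : α + Pi.single i 1 ≠ 0 := fun h => by simpa using congrFun h i
  rw [backwardShift_ncoeff, const_apply, ncoeff_single, if_neg h, smul_zero]
  rfl

lemma backwardShift_single_add (i : Fin n) (α : Fin n → ℕ) (e : E) :
    backwardShift i (single m (α + Pi.single i 1) e) =
      single m α (((√(rho m α / rho m (α + Pi.single i 1)) : ℝ) : ℂ) • e) := by
  refine ext_ncoeff fun β => ?_
  rw [backwardShift_ncoeff, ncoeff_single, ncoeff_single]
  by_cases h : β = α
  · simp [h]
  · simp [h]

lemma backwardShift_single_of_eq_zero (i : Fin n) {α : Fin n → ℕ} (hα : α i = 0) (e : E) :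
    backwardShift i (single m α e) = 0 := by
  refine ext_ncoeff fun β => ?_
  have h : β + Pi.single i 1 ≠ α := fun h => by simp [← h] at hα
  rw [backwardShift_ncoeff, ncoeff_single, if_neg h, smul_zero]
  rfl

/-- This is the eigenvalue of `M_{z_i} Δ M_{z_i}^*` on `z^{α + e_i}`. In terms of `γ = α + e_i` it
reads `γ_i / |γ|`, and these add up to one over `i`; this dictates the factors in `ratio`. -/
lemma rho_div_mul_ratio (α : Fin n → ℕ) (i : Fin n) :
    rho m α / rho m (α + Pi.single i 1) * ratio m α = (α i + 1) / (len α + 1) := by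
  have h := rho_add_single m α i
  have h1 := (rho_pos m (α + Pi.single i 1)).ne'
  have h2 : (len α : ℝ) + 1 ≠ 0 := by positivity
  rw [ratio]
  field_simp
  linarith

/-- `∑ M_{z_i} Δ M_{z_i}^*` is the projection onto the orthogonal complement of the constants. -/
lemma sum_mulCoord_diag_backwardShift (f : HmBall m n E) :
    ∑ i, mulCoord i (diag m n E (backwardShift i f)) = f - const m n E (f.ncoeff 0) := by
  refine ext_ncoeff fun α => ext_inner_left ℂ fun e => ?_
  -- `M_{z_i} Δ M_{z_i}^*` scales the coefficient at `α` by `α_i / |α|`. Degree zero is separated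
  -- because there the constant is removed.
  have key : ∀ i, inner ℂ (single m α e) (mulCoord i (diag m n E (backwardShift i f))) =
      if len α = 0 then 0 else ((α i : ℂ) / len α) * inner ℂ e (f.ncoeff α) := by
    intro i
    rw [← adjoint_inner_left, adjoint_mulCoord]
    by_cases hi : α i = 0
    · rw [backwardShift_single_of_eq_zero i hi]
      simp [hi]
    · obtain ⟨β, rfl⟩ : ∃ β : Fin n → ℕ, α = β + Pi.single i 1 := by
        refine ⟨α - Pi.single i 1, (tsub_add_cancel_of_le ?_).symm⟩
        intro j
        by_cases hj : j = i
        · subst hj; simp; omega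
        · simp [hj]
      have h0 := rho_div_mul_ratio (m := m) β i
      -- Each slot of the inner product contributes one square root from the weighted shift.
      rw [← Real.mul_self_sqrt (div_nonneg (rho_pos m β).le (rho_pos m (β + Pi.single i 1)).le)]
        at h0
      have h1 : (((√(rho m β / rho m (β + Pi.single i 1)) : ℝ) : ℂ) *
          ((√(rho m β / rho m (β + Pi.single i 1)) : ℝ) : ℂ)) * ((ratio m β : ℝ) : ℂ) =
          ((β i : ℂ) + 1) / ((len β : ℂ) + 1) := by
        have h1 := congrArg (fun t : ℝ => (t : ℂ)) h0
        push_cast at h1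
        exact h1
      rw [backwardShift_single_add, inner_single_left, diag_ncoeff, backwardShift_ncoeff,
        inner_smul_left, inner_smul_right, inner_smul_right, Complex.conj_ofReal,
        len_add_single, if_neg (Nat.succ_ne_zero _)]
      push_cast
      rw [Pi.add_apply, Pi.single_eq_same, Nat.cast_add, Nat.cast_one, ← h1]
      ring
  rw [← inner_single_left, ← inner_single_left, inner_sum, Finset.sum_congr rfl fun i _ => key i,
    inner_sub_right, inner_single_left, inner_single_left, const_apply, ncoeff_single]
  by_cases h : len α = 0
  · have : α = 0 := by
      ext i
      simpa using (Finset.sum_eq_zero_iff.1 h) i (Finset.mem_univ i)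
    simp [this, len]
  · have h0 : α ≠ 0 := fun h' => h (by simp [h', len])
    have h1 : (len α : ℂ) ≠ 0 := by exact_mod_cast h
    simp only [h, h0, if_false, inner_zero_right, sub_zero]
    rw [← Finset.sum_mul, ← Finset.sum_div, ← Nat.cast_sum, show ∑ i, α i = len α from rfl,
      div_self h1, one_mul]

lemma sum_mulCoord_eval (f : Fin n → HmBall m n E) (z : Ball n) :
    (∑ i, mulCoord i (f i)) z = ∑ i, z.1 i • f i z := by
  have h : evalCLM z (∑ i, mulCoord i (f i)) = ∑ i, evalCLM z (mulCoord i (f i)) :=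
    map_sum _ _ _
  exact h.trans (Finset.sum_congr rfl fun i _ => mulCoord_apply i (f i) z)

end HmBall

end Model

/-! ### The canonical dilation of a pure hypercontraction -/

section Fibers

variable {n : ℕ}

lemma len_eq_of_mem_piAntidiag {α : Fin n → ℕ} {k : ℕ}
    (hα : α ∈ Finset.piAntidiag (Finset.univ : Finset (Fin n)) k) : len α = k := by
  simpa [len] using hα

/-- For nonnegative terms, convergence of the sums over homogeneous degrees already bounds every
finite partial sum. -/
lemma hasSum_of_hasSum_fiber {f : (Fin n → ℕ) → ℝ} (hf : ∀ α, 0 ≤ f α) {a : ℝ}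
    (h : HasSum (fun k => ∑ α ∈ Finset.piAntidiag (Finset.univ : Finset (Fin n)) k, f α) a) :
    HasSum f a := by
  have hs : Summable f := by
    refine summable_of_sum_le (c := a) hf fun u => ?_
    have hsub : u ⊆ (u.image len).biUnion
        fun k => Finset.piAntidiag (Finset.univ : Finset (Fin n)) k := by
      intro α hα
      simp only [Finset.mem_biUnion, Finset.mem_image]
      exact ⟨len α, ⟨α, hα, rfl⟩, by simp [len]⟩
    refine (Finset.sum_le_sum_of_subset_of_nonneg hsub fun α _ _ => hf α).trans ?_
    rw [Finset.sum_biUnion]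
    · exact sum_le_hasSum _ (fun k _ => Finset.sum_nonneg fun α _ => hf α) h
    · intro a _ b _ hab
      exact Finset.disjoint_left.2 fun α ha hb => hab <|
        (len_eq_of_mem_piAntidiag ha).symm.trans (len_eq_of_mem_piAntidiag hb)
  have h1 := hs.hasSum
  rwa [(hasSum_fiber h1).unique h] at h1

/-- With `k = |α|`, the hockey-stick identity gives `∑_{j<m} C(k + j, j) = C(m + k, k + 1)`, which
is `(m + k) / (k + 1)` times `C(m + k - 1, k)`. So summing the binomial series of all orders below
`m` produces exactly the weight of `Δ`. -/
lemma ratio_mul_rho (m : ℕ) [NeZero m] (α : Fin n → ℕ) :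
    HmBall.ratio m α * rho m α =
      (∑ j ∈ Finset.range m, ((len α + j).choose j : ℝ)) * Nat.multinomial Finset.univ α := by
  obtain ⟨p, rfl⟩ : ∃ p, m = p + 1 := ⟨m - 1, (Nat.sub_add_cancel NeZero.one_le).symm⟩
  have h1 : ∑ j ∈ Finset.range (p + 1), (len α + j).choose j =
      (p + len α + 1).choose (len α + 1) := by
    rw [← Nat.sum_range_add_choose]
    exact Finset.sum_congr rfl fun j _ => by rw [add_comm, Nat.choose_symm_add]
  have h2 := Nat.add_one_mul_choose_eq (p + len α) (len α)
  have h3 : (len α + p).choose p = (p + len α).choose (len α) := by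
    rw [add_comm, Nat.choose_symm_add]
  rw [rho_eq, ← Nat.cast_sum, h1, HmBall.ratio, Nat.add_sub_cancel, h3, ← mul_assoc]
  congr 1
  have h4 : (len α : ℝ) + 1 ≠ 0 := by positivity
  rw [div_mul_eq_mul_div, div_eq_iff h4]
  have h5 : ((p + len α + 1 : ℕ) : ℝ) * ((p + len α).choose (len α) : ℝ) =
      ((p + len α + 1).choose (len α + 1) : ℝ) * ((len α + 1 : ℕ) : ℝ) := by
    exact_mod_cast h2
  push_cast at h5 ⊢
  rw [← h5]
  ring

end Fibers

section Dilation

variable {n m : ℕ} [NeZero m]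
  {H : Type*} [NormedAddCommGroup H] [InnerProductSpace ℂ H] [CompleteSpace H]
  {E : Type*} [NormedAddCommGroup E] [InnerProductSpace ℂ E] [CompleteSpace E]
  {T : Fin n → H →L[ℂ] H} {C : H →L[ℂ] E}

/-- The highest summation order `j = m - 1` reaches `Δ_T^{(0)} = 1`; this is the isometry of `j_C`.
-/
lemma hasSum_rho_mul_norm_sq (hT : ∀ i j, Commute (T i) (T j)) (hpure : IsPure T)
    (hC : adjoint C ∘L C = defect T m) (x : H) :
    HasSum (fun α => rho m α * ‖C (tuplePow (fun i => adjoint (T i)) α x)‖ ^ 2) (‖x‖ ^ 2) := by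
  refine hasSum_of_hasSum_fiber (fun α => mul_nonneg (rho_pos m α).le (sq_nonneg _)) ?_
  have h := hasSum_choose_mul_norm_sq hT hpure hC (Nat.sub_one_lt (NeZero.ne m)) x
  have h1 : (inner ℂ (defect T (m - (m - 1 + 1)) x) x).re = ‖x‖ ^ 2 := by
    rw [Nat.sub_add_cancel NeZero.one_le, Nat.sub_self, defect, pow_zero, Module.End.one_apply,
      id_apply, inner_self_eq_norm_sq_to_K]
    norm_cast
  rw [h1] at h
  refine h.congr_fun fun k => ?_
  rw [Finset.mul_sum]
  refine Finset.sum_congr rfl fun α hα => ?_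
  rw [rho_eq, len_eq_of_mem_piAntidiag hα, mul_assoc]

/-- Adds the binomial series for all `j < m`, whose limits are the quadratic forms of `Δ_T^{(0)}, …,
Δ_T^{(m-1)}`. -/
lemma hasSum_ratio_mul_rho_mul_norm_sq (hT : ∀ i j, Commute (T i) (T j)) (hpure : IsPure T)
    (hC : adjoint C ∘L C = defect T m) (x : H) :
    HasSum (fun α => HmBall.ratio m α * rho m α *
        ‖C (tuplePow (fun i => adjoint (T i)) α x)‖ ^ 2)
      (inner ℂ ((∑ k ∈ Finset.range m, defect T k) x) x).re := by
  refine hasSum_of_hasSum_fiber (fun α => mul_nonneg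
    (mul_pos (HmBall.ratio_pos m α) (rho_pos m α)).le (sq_nonneg _)) ?_
  have h := hasSum_sum fun j (hj : j ∈ Finset.range m) =>
    hasSum_choose_mul_norm_sq hT hpure hC (Finset.mem_range.1 hj) x
  have h1 : (inner ℂ ((∑ k ∈ Finset.range m, defect T k) x) x).re =
      ∑ j ∈ Finset.range m, (inner ℂ (defect T (m - (j + 1)) x) x).re := by
    rw [sum_apply, sum_inner, Complex.re_sum,
      ← Finset.sum_range_reflect (fun k => (inner ℂ (defect T k x) x).re)]
    exact Finset.sum_congr rfl fun j _ => by rw [Nat.sub_sub, add_comm 1 j]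
  rw [h1]
  refine h.congr_fun fun k => ?_
  rw [← Finset.sum_mul, Finset.mul_sum]
  refine Finset.sum_congr rfl fun α hα => ?_
  rw [ratio_mul_rho, len_eq_of_mem_piAntidiag hα, mul_assoc]

lemma norm_sqrt_rho_smul_sq (α : Fin n → ℕ) (e : E) :
    ‖(√(rho m α) : ℂ) • e‖ ^ 2 = rho m α * ‖e‖ ^ 2 := by
  rw [norm_smul, mul_pow, Complex.norm_real, Real.norm_eq_abs, sq_abs,
    Real.sq_sqrt (rho_pos m α).le]

lemma summable_dilation (hT : ∀ i j, Commute (T i) (T j)) (hpure : IsPure T)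
    (hC : adjoint C ∘L C = defect T m) (x : H) :
    Summable fun α => ‖(√(rho m α) : ℂ) • C (tuplePow (fun i => adjoint (T i)) α x)‖ ^ 2 := by
  simpa only [norm_sqrt_rho_smul_sq] using (hasSum_rho_mul_norm_sq hT hpure hC x).summable

/-- The map `j_C` as an operator into `H_m(𝔹, E)`. -/
noncomputable def dilationCLM (hT : ∀ i j, Commute (T i) (T j)) (hpure : IsPure T)
    (hC : adjoint C ∘L C = defect T m) : H →L[ℂ] HmBall m n E :=
  LinearMap.mkContinuous
    { toFun := fun x => HmBall.ofNcoeff m _ (summable_dilation hT hpure hC x)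
      map_add' := fun x y => HmBall.ext_ncoeff fun α => by
        simp only [HmBall.ncoeff_add, HmBall.ncoeff_ofNcoeff, map_add, smul_add]
      map_smul' := fun c x => HmBall.ext_ncoeff fun α => by
        simp only [RingHom.id_apply, HmBall.ncoeff_smul, HmBall.ncoeff_ofNcoeff, map_smul]
        rw [smul_comm] }
    1 (fun x => by
      rw [one_mul]
      refine le_of_sq_le_sq ?_ (norm_nonneg _)
      have h := HmBall.norm_sq_eq (HmBall.ofNcoeff m _ (summable_dilation hT hpure hC x))
      simp only [HmBall.ncoeff_ofNcoeff, norm_sqrt_rho_smul_sq] at h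
      exact (h.unique (hasSum_rho_mul_norm_sq hT hpure hC x)).le)

variable (hT : ∀ i j, Commute (T i) (T j)) (hpure : IsPure T) (hC : adjoint C ∘L C = defect T m)

lemma dilationCLM_ncoeff (x : H) (α : Fin n → ℕ) : (dilationCLM hT hpure hC x).ncoeff α =
    (√(rho m α) : ℂ) • C (tuplePow (fun i => adjoint (T i)) α x) := rfl

lemma sqrt_rho_mul_self (m : ℕ) [NeZero m] (α : Fin n → ℕ) :
    (√(rho m α) : ℂ) * (√(rho m α) : ℂ) = (rho m α : ℂ) := by
  rw [← Complex.ofReal_mul, Real.mul_self_sqrt (rho_pos m α).le]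

lemma dilationCLM_eval (x : H) : ⇑(dilationCLM hT hpure hC x) = dilation m T C x := by
  funext z
  rw [HmBall.apply_eq, dilation]
  refine tsum_congr fun α => ?_
  rw [dilationCLM_ncoeff, smul_smul, mul_right_comm, sqrt_rho_mul_self]

lemma dilationCLM_ncoeff_zero (x : H) : (dilationCLM hT hpure hC x).ncoeff 0 = C x := by
  rw [dilationCLM_ncoeff]
  simp [tuplePow, rho, len, Nat.factorial_ne_zero]

/-- The shift weight replaces `ρ_m(α + e_i)` by `ρ_m(α)`, and `T^{*(α + e_i)} = T^{*α} T_i^*`. -/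
lemma backwardShift_dilationCLM (i : Fin n) (x : H) :
    HmBall.backwardShift i (dilationCLM hT hpure hC x) =
      dilationCLM hT hpure hC (adjoint (T i) x) := by
  refine HmBall.ext_ncoeff fun α => ?_
  rw [HmBall.backwardShift_ncoeff, dilationCLM_ncoeff, dilationCLM_ncoeff, smul_smul,
    ← Complex.ofReal_mul, ← Real.sqrt_mul (div_nonneg (rho_pos _ _).le (rho_pos _ _).le),
    div_mul_cancel₀ _ (rho_pos _ _).ne', tuplePow_add_single (commute_adjoint hT), mul_def,
    comp_apply]

lemma isSelfAdjoint_defect (T : Fin n → H →L[ℂ] H) (k : ℕ) : IsSelfAdjoint (defect T k) := by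
  induction k with
  | zero => exact IsSelfAdjoint.one (H →L[ℂ] H)
  | succ k ih =>
    have h : defect T (k + 1) = defect T k - sigma T (defect T k) := by
      simpa using sigma_pow_defect_succ T k 0
    rw [h]
    refine ih.sub ?_
    rw [sigma_eq_sum_conjHom, LinearMap.sum_apply]
    refine isSelfAdjoint_sum _ fun i _ => ?_
    rw [conjHom_apply]
    exact ih.conjugate (T i)

lemma inner_sum_defect_left (a b : H) :
    inner ℂ ((∑ k ∈ Finset.range m, defect T k) a) b =
      inner ℂ a ((∑ k ∈ Finset.range m, defect T k) b) := by
  have h : IsSelfAdjoint (∑ k ∈ Finset.range m, defect T k) :=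
    isSelfAdjoint_sum _ fun k _ => isSelfAdjoint_defect T k
  exact h.isSymmetric a b

/-- The dilation intertwines `∑ Δ_T^{(k)}` and the diagonal operator. -/
lemma inner_dilationCLM_diag (a b : H) :
    inner ℂ (dilationCLM hT hpure hC a) (HmBall.diag m n E (dilationCLM hT hpure hC b)) =
      inner ℂ a ((∑ k ∈ Finset.range m, defect T k) b) := by
  set J := dilationCLM hT hpure hC
  set Y := ∑ k ∈ Finset.range m, defect T k with hY
  have hquad : ∀ x, inner ℂ x (Y x) = inner ℂ (J x) (HmBall.diag m n E (J x)) := by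
    intro x
    have h1 := HmBall.inner_eq (J x) (HmBall.diag m n E (J x))
    have h2 := (Complex.hasSum_ofReal).2 (hasSum_ratio_mul_rho_mul_norm_sq hT hpure hC x)
    have h3 : inner ℂ (J x) (HmBall.diag m n E (J x)) = ((inner ℂ (Y x) x).re : ℂ) := by
      refine h1.unique (h2.congr_fun fun α => ?_)
      rw [HmBall.diag_ncoeff, dilationCLM_ncoeff, inner_smul_right, inner_self_eq_norm_sq_to_K,
        mul_assoc, ← norm_sqrt_rho_smul_sq]
      push_cast
      rfl
    -- The series computes only a real part; self-adjointness of `Y` makes the form real.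
    rw [h3, ← inner_sum_defect_left]
    exact (Complex.conj_eq_iff_re.1 (by rw [inner_conj_symm, ← inner_sum_defect_left])).symm
  -- Complex polarization: operators with equal quadratic forms coincide.
  have hop : (Y : H →ₗ[ℂ] H) = (adjoint J ∘L HmBall.diag m n E ∘L J : H →L[ℂ] H) := by
    refine (ext_inner_map _ _).1 fun x => ?_
    have h := congrArg (starRingEnd ℂ) (hquad x)
    rw [inner_conj_symm, inner_conj_symm] at h
    simpa [adjoint_inner_left] using h
  have h := congrArg (fun A : H →ₗ[ℂ] H => inner ℂ a (A b)) hop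
  simpa [adjoint_inner_right] using h.symm

/-- Both sides are compared degree by degree: the degree-`k` part of `∑_{j<m} (1 - Z T^*)^{-(j+1)}`
is `∑_{j<m} C(k + j, j) (Z T^*)^k`, and `ratio_mul_rho` identifies its coefficients with those of `Δ
j_C b`. -/
lemma diag_dilationCLM_eval (hT1 : (defect T 1).IsPositive) (b : H) (z : Ball n) :
    HmBall.diag m n E (dilationCLM hT hpure hC b) z =
      C ((∑ k ∈ Finset.Icc 1 m, resolventZT T z.1 ^ k) b) := by
  have h1 := hasSum_fiber (HmBall.eval_eq_tsum (HmBall.diag m n E (dilationCLM hT hpure hC b)) z)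
  have h2 := hasSum_sum fun j (_ : j ∈ Finset.range m) => hasSum_resolventZT_pow hT1 z.2 j
  have h3 := (h2.mapL (ContinuousLinearMap.apply ℂ H b)).mapL C
  have h4 : ∑ k ∈ Finset.Icc 1 m, resolventZT T z.1 ^ k =
      ∑ j ∈ Finset.range m, resolventZT T z.1 ^ (j + 1) := by
    rw [← Finset.Ico_add_one_right_eq_Icc, Finset.sum_Ico_eq_sum_range, Nat.add_sub_cancel]
    exact Finset.sum_congr rfl fun j _ => by rw [add_comm]
  rw [h4]
  refine h1.unique (h3.congr_fun fun k => ?_)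
  rw [← Finset.sum_smul, rowZ_comp_adjCol_pow hT, Finset.smul_sum, map_sum, map_sum]
  refine Finset.sum_congr rfl fun α hα => ?_
  have h5 : ((HmBall.ratio m α : ℝ) : ℂ) * (rho m α : ℂ) =
      (∑ j ∈ Finset.range m, ((k + j).choose j : ℂ)) * Nat.multinomial Finset.univ α := by
    rw [← len_eq_of_mem_piAntidiag hα]
    exact_mod_cast congrArg (fun t : ℝ => (t : ℂ)) (ratio_mul_rho m α)
  rw [HmBall.diag_ncoeff, dilationCLM_ncoeff, smul_smul, smul_smul, smul_smul, map_smul, map_smul,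
    ContinuousLinearMap.apply_apply, ← mul_assoc (∑ j ∈ Finset.range m, _), ← h5,
    ← sqrt_rho_mul_self]
  congr 1
  ring

end Dilation

/-! ### Inner functions -/

section Inner

variable {n : ℕ}

lemma tuplePow_apply_intertwine {H K : Type*} [NormedAddCommGroup H] [NormedSpace ℂ H]
    [NormedAddCommGroup K] [NormedSpace ℂ K] {S : Fin n → H →L[ℂ] H} {A : Fin n → K →L[ℂ] K}
    {J : H →L[ℂ] K} (h : ∀ i x, A i (J x) = J (S i x)) (α : Fin n → ℕ) (x : H) :
    tuplePow A α (J x) = J (tuplePow S α x) := by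
  induction n with
  | zero => simp [tuplePow]
  | succ n ih =>
    have h1 := ih (fun i x => h i.succ x) (fun i => α i.succ)
    have h2 : ∀ (k : ℕ) (y : H), (A 0 ^ k) (J y) = J ((S 0 ^ k) y) := by
      intro k
      induction k with
      | zero => simp
      | succ k ihk =>
        intro y
        rw [pow_succ, pow_succ, mul_def, mul_def, comp_apply, comp_apply, h, ihk]
    simp only [tuplePow, List.ofFn_succ, List.prod_cons] at h1 ⊢
    rw [mul_def, mul_def, comp_apply, comp_apply, h1, h2]

lemma tuplePow_single_add {R : Type*} [Monoid R] {S : Fin n → R}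
    (hS : ∀ i j, Commute (S i) (S j)) (α : Fin n → ℕ) (i : Fin n) :
    tuplePow S (α + Pi.single i 1) = S i * tuplePow S α := by
  rw [tuplePow_add_single hS, tuplePow]
  refine (Commute.list_prod_right _ _ fun x hx => ?_).symm.eq
  obtain ⟨j, rfl⟩ := (List.mem_ofFn' _ _).1 hx
  exact (hS i j).pow_right _

lemma exists_eq_add_single {α : Fin n → ℕ} (hα : α ≠ 0) :
    ∃ (i : Fin n) (β : Fin n → ℕ), α = β + Pi.single i 1 := by
  obtain ⟨i, hi⟩ := Function.ne_iff.1 hα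
  refine ⟨i, α - Pi.single i 1, (tsub_add_cancel_of_le fun j => ?_).symm⟩
  by_cases hj : j = i
  · subst hj
    simpa [Nat.one_le_iff_ne_zero] using hi
  · simp [hj]

lemma HmBall.commute_mulCoord {m : ℕ} [NeZero m] {E : Type*} [NormedAddCommGroup E]
    [InnerProductSpace ℂ E] [CompleteSpace E] (i j : Fin n) :
    Commute (HmBall.mulCoord (m := m) (E := E) i) (HmBall.mulCoord j) := by
  ext1 f
  refine RKHS.ext fun z => ?_
  simp only [mul_def, comp_apply, HmBall.mulCoord_apply]
  exact smul_comm _ _ _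

variable {m : ℕ} [NeZero m]
  {H : Type*} [NormedAddCommGroup H] [InnerProductSpace ℂ H] [CompleteSpace H]
  {E' : Type*} [NormedAddCommGroup E'] [InnerProductSpace ℂ E'] [CompleteSpace E']
  {E : Type*} [NormedAddCommGroup E] [InnerProductSpace ℂ E] [CompleteSpace E]
  {T : Fin n → H →L[ℂ] H} {C : H →L[ℂ] E}

lemma analyticAt_transfer (hT1 : (defect T 1).IsPositive) (m : ℕ)
    (B : E' →L[ℂ] PiLp 2 (fun _ : Fin n => H)) (C : H →L[ℂ] E) (D : E' →L[ℂ] E)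
    {z : EuclideanSpace ℂ (Fin n)} (hz : z ∈ Metric.ball (0 : EuclideanSpace ℂ (Fin n)) 1) :
    AnalyticAt ℂ (fun w => D + C ∘L (∑ k ∈ Finset.Icc 1 m, resolventZT T w ^ k) ∘L
      rowZ H w ∘L B) z := by
  have h1 : AnalyticAt ℂ (fun w => ∑ k ∈ Finset.Icc 1 m, resolventZT T w ^ k) z :=
    Finset.analyticAt_fun_sum _ fun k _ => (analyticAt_resolventZT hT1 hz).pow k
  have h2 : AnalyticAt ℂ (fun w => (∑ k ∈ Finset.Icc 1 m, resolventZT T w ^ k) ∘L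
      rowZ H w ∘L B) z :=
    AnalyticAt.comp₂ (h := fun p : (H →L[ℂ] H) × (E' →L[ℂ] H) => p.1 ∘L p.2)
      ((compL ℂ E' H H).analyticAt_bilinear _) h1 (analyticAt_rowZ_comp B z)
  exact analyticAt_const.add (((compL ℂ E' H E C).analyticAt _).comp h2)

/-! ### The multiplier `x ↦ W x` and its adjoint shifts -/

variable (hT : ∀ i j, Commute (T i) (T j)) (hpure : IsPure T) (hC : adjoint C ∘L C = defect T m)

/-- The operator `x ↦ D x + ∑ M_{z_i} Δ j_C (B x)_i`. -/
noncomputable def transferCLM (B : E' →L[ℂ] PiLp 2 (fun _ : Fin n => H)) (D : E' →L[ℂ] E) :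
    E' →L[ℂ] HmBall m n E :=
  HmBall.const m n E ∘L D + ∑ i, HmBall.mulCoord i ∘L HmBall.diag m n E ∘L
    dilationCLM hT hpure hC ∘L PiLp.proj 2 (fun _ : Fin n => H) i ∘L B

variable (B : E' →L[ℂ] PiLp 2 (fun _ : Fin n => H)) (D : E' →L[ℂ] E)

lemma transferCLM_apply (x : E') : transferCLM hT hpure hC B D x =
    HmBall.const m n E (D x) + ∑ i, HmBall.mulCoord i
      (HmBall.diag m n E (dilationCLM hT hpure hC (B x i))) := by
  simp [transferCLM, sum_apply]

lemma transferCLM_eval (hT1 : (defect T 1).IsPositive) (x : E') (z : Ball n) :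
    transferCLM hT hpure hC B D x z =
      (D + C ∘L (∑ k ∈ Finset.Icc 1 m, resolventZT T z.1 ^ k) ∘L rowZ H z.1 ∘L B) x := by
  rw [transferCLM_apply, RKHS.coe_add, Pi.add_apply, HmBall.const_eval, HmBall.sum_mulCoord_eval,
    add_apply, comp_apply, comp_apply, comp_apply, rowZ_apply, map_sum, map_sum]
  congr 1
  refine Finset.sum_congr rfl fun i _ => ?_
  rw [diag_dilationCLM_eval hT hpure hC hT1, map_smul, map_smul]

lemma inner_const_transferCLM (e : E) (x : E') :
    inner ℂ (HmBall.const m n E e) (transferCLM hT hpure hC B D x) = inner ℂ e (D x) := by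
  rw [transferCLM_apply, inner_add_right, inner_sum, Finset.sum_eq_zero fun i _ => ?_, add_zero,
    HmBall.const_apply, HmBall.inner_single_left, HmBall.const_apply, HmBall.ncoeff_single,
    if_pos rfl]
  rw [← adjoint_inner_left, HmBall.adjoint_mulCoord, HmBall.backwardShift_const, inner_zero_left]

variable {B D}

/-- The place where (KI4) acts: writing `j_C (B x)_i = M_{z_i}^* f` turns the sum into `f - f(0)`,
and `M_{z_i}^*` annihilates constants. -/
lemma backwardShift_transferCLM
    (hB : ∀ x : E', ∃ f : HmBall m n E, ∀ i : Fin n,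
      dilation m T C (B x i) = (HmBall.mulCoord i).adjoint f) (x : E') (i : Fin n) :
    HmBall.backwardShift i (transferCLM hT hpure hC B D x) =
      dilationCLM hT hpure hC (B x i) := by
  obtain ⟨f, hf⟩ := hB x
  have hf' : ∀ i, dilationCLM hT hpure hC (B x i) = HmBall.backwardShift i f := fun i => by
    -- (KI4) is an equality of functions on the ball; an element of `H_m(𝔹, E)` is determined by its
    -- values.
    refine DFunLike.coe_injective ?_
    rw [dilationCLM_eval, hf, HmBall.adjoint_mulCoord]
  rw [transferCLM_apply]
  simp only [hf']
  rw [HmBall.sum_mulCoord_diag_backwardShift, map_add, map_sub, HmBall.backwardShift_const,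
    HmBall.backwardShift_const, sub_zero, zero_add]

/-- Moving `M_{z_i}` to the left turns `j_C h` into `j_C T_i^* h`, so compression of `Δ` to `Y`
leaves `⟨C h, D y⟩ + ∑ ⟨T_i^* h, Y (B y)_i⟩`, which (KI2) cancels. -/
lemma inner_dilationCLM_transferCLM
    (hKI2 : D.adjoint ∘L C =
      -(B.adjoint ∘L directSum n (∑ k ∈ Finset.range m, defect T k) ∘L adjCol T))
    (h : H) (y : E') :
    inner ℂ (dilationCLM hT hpure hC h) (transferCLM hT hpure hC B D y) = 0 := by
  have h1 := congrArg (fun A : H →L[ℂ] E' => inner ℂ (A h) y) hKI2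
  simp only [comp_apply, neg_apply, inner_neg_left, adjoint_inner_left, PiLp.inner_apply,
    directSum_apply, adjCol_apply, inner_sum_defect_left] at h1
  have h2 : inner ℂ (dilationCLM hT hpure hC h) (HmBall.const m n E (D y)) =
      inner ℂ (C h) (D y) := by
    rw [← inner_conj_symm, HmBall.const_apply, HmBall.inner_single_left, inner_conj_symm,
      dilationCLM_ncoeff_zero]
  rw [transferCLM_apply, inner_add_right, inner_sum, h2, h1, neg_add_eq_zero]
  refine Finset.sum_congr rfl fun i _ => ?_
  rw [← adjoint_inner_left, ← adjoint_inner_left (HmBall.mulCoord i), HmBall.adjoint_mulCoord,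
    backwardShift_dilationCLM, inner_dilationCLM_diag]

lemma norm_transferCLM
    (hKI3 : D.adjoint ∘L D +
      B.adjoint ∘L directSum n (∑ k ∈ Finset.range m, defect T k) ∘L B =
        ContinuousLinearMap.id ℂ E')
    (hB : ∀ x : E', ∃ f : HmBall m n E, ∀ i : Fin n,
      dilation m T C (B x i) = (HmBall.mulCoord i).adjoint f) (x : E') :
    ‖transferCLM hT hpure hC B D x‖ = ‖x‖ := by
  have h1 := congrArg (fun A : E' →L[ℂ] E' => inner ℂ x (A x)) hKI3
  simp only [comp_apply, add_apply, id_apply, inner_add_right, adjoint_inner_right,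
    PiLp.inner_apply, directSum_apply] at h1
  have h2 : inner ℂ (transferCLM hT hpure hC B D x) (transferCLM hT hpure hC B D x) =
      inner ℂ x x := by
    rw [← h1]
    -- Only the right slot is expanded; the left one stays intact to absorb `M_{z_i}^*`, leaving `‖D
    -- x‖² + ∑ ⟨(B x)_i, Y (B x)_i⟩`.
    nth_rewrite 2 [transferCLM_apply]
    rw [inner_add_right, inner_sum, ← inner_conj_symm, inner_const_transferCLM, inner_conj_symm]
    congr 1
    refine Finset.sum_congr rfl fun i _ => ?_
    rw [← adjoint_inner_left, HmBall.adjoint_mulCoord, backwardShift_transferCLM hT hpure hC hB,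
      inner_dilationCLM_diag]
  rw [inner_self_eq_norm_sq_to_K, inner_self_eq_norm_sq_to_K] at h2
  have h3 : ‖transferCLM hT hpure hC B D x‖ ^ 2 = ‖x‖ ^ 2 := by exact_mod_cast h2
  exact (sq_eq_sq₀ (norm_nonneg _) (norm_nonneg _)).1 h3

/-- One adjoint shift sends `V x` into the range of `j_C`, the remaining ones keep it there by
intertwining, and that range is orthogonal to the range of `V`. -/
lemma inner_tuplePow_transferCLM
    (hKI2 : D.adjoint ∘L C =
      -(B.adjoint ∘L directSum n (∑ k ∈ Finset.range m, defect T k) ∘L adjCol T))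
    (hB : ∀ x : E', ∃ f : HmBall m n E, ∀ i : Fin n,
      dilation m T C (B x i) = (HmBall.mulCoord i).adjoint f)
    {α : Fin n → ℕ} (hα : α ≠ 0) (x y : E') :
    inner ℂ (tuplePow HmBall.mulCoord α (transferCLM hT hpure hC B D y))
      (transferCLM hT hpure hC B D x) = 0 := by
  obtain ⟨i, β, rfl⟩ := exists_eq_add_single hα
  have h1 : adjoint (tuplePow (HmBall.mulCoord (m := m) (E := E)) β) =
      tuplePow HmBall.backwardShift β := by
    refine (star_tuplePow HmBall.commute_mulCoord β).trans ?_
    simp only [star_eq_adjoint, HmBall.adjoint_mulCoord]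
  rw [tuplePow_single_add HmBall.commute_mulCoord, mul_def, comp_apply, ← adjoint_inner_right,
    HmBall.adjoint_mulCoord, backwardShift_transferCLM hT hpure hC hB, ← adjoint_inner_right, h1,
    tuplePow_apply_intertwine (backwardShift_dilationCLM hT hpure hC), ← inner_conj_symm,
    inner_dilationCLM_transferCLM hT hpure hC hKI2, map_zero]

end Inner

end BallSpace

theorem mainTheorem1 {H E' E : Type*}
    [NormedAddCommGroup H] [InnerProductSpace ℂ H] [CompleteSpace H]
    [NormedAddCommGroup E'] [InnerProductSpace ℂ E'] [CompleteSpace E']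
    [NormedAddCommGroup E] [InnerProductSpace ℂ E] [CompleteSpace E]
    (n m : ℕ) [NeZero m]
    (T : Fin n → H →L[ℂ] H) (hT : IsHypercontraction m T) (hpure : IsPure T)
    (B : E' →L[ℂ] PiLp 2 (fun _ : Fin n => H)) (C : H →L[ℂ] E) (D : E' →L[ℂ] E)
    (hKI1 : C.adjoint ∘L C = defect T m)
    (hKI2 : D.adjoint ∘L C =
      -(B.adjoint ∘L directSum n (∑ k ∈ Finset.range m, defect T k) ∘L adjCol T))
    (hKI3 : D.adjoint ∘L D +
      B.adjoint ∘L directSum n (∑ k ∈ Finset.range m, defect T k) ∘L B =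
        ContinuousLinearMap.id ℂ E')
    (hKI4 : ∀ x : E', ∃ f : HmBall m n E, ∀ i : Fin n,
      dilation m T C (B x i) = (HmBall.mulCoord i).adjoint f)
    (W : EuclideanSpace ℂ (Fin n) → E' →L[ℂ] E)
    (hW : ∀ z ∈ Metric.ball (0 : EuclideanSpace ℂ (Fin n)) 1,
      W z = D + C ∘L (∑ k ∈ Finset.Icc 1 m, resolventZT T z ^ k) ∘L rowZ H z ∘L B) :
    IsKmInner m W := by
  refine ⟨fun z hz => ?_, ⟨(transferCLM hT.commute hpure hKI1 B D).toLinearMap,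
    norm_transferCLM hT.commute hpure hKI1 hKI3 hKI4⟩, fun x z => ?_, fun α hα x y => ?_⟩
  -- `W` is prescribed only on the ball, so analyticity is transferred through equality on a
  -- neighbourhood.
  · refine (analyticAt_transfer hT.defect_one_nonneg m B C D hz).congr ?_
    filter_upwards [Metric.isOpen_ball.mem_nhds hz] with w hw
    exact (hW w hw).symm
  · rw [hW z.1 z.2]
    exact transferCLM_eval hT.commute hpure hKI1 B D hT.defect_one_nonneg x z
  · exact inner_tuplePow_transferCLM hT.commute hpure hKI1 hKI2 hKI4 hα x y
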